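/- \textbf{Proposition (Einstein d-tensor identities).} Let $T$ and $M$ be smooth manifolds with $\dim T=p$, $\dim M=n$, and let $(t^\alpha,x^i,x^i_\alpha)$ be the coordinates induced on the jet space $J^1(T,M)$ by charts of $T$ and $M$. Let $h_{\alpha\beta}(t^\gamma)$ be a smooth semi-Riemannian metric, $g_{ij}(t^\gamma,x^k,x^k_\gamma)$ a smooth, symmetric, nondegenerate spatial metrical d-tensor and $N^{(i)}_{(\alpha)j}(t^\gamma,x^k,x^k_\gamma)$ an arbitrary smooth spatial nonlinear connection, on an open subset of $J^1(T,M)$. Repeated indices are summed, $h^{\alpha\beta}$ and $g^{ij}$ denote inverse matrices, $H^\gamma_{\alpha\beta}$ are the Christoffel symbols of $h$, $M^{(i)}_{(\alpha)\beta}=-H^\gamma_{\alpha\beta}x^i_\gamma$, and $$\frac{\delta}{\delta t^\alpha}=\frac{\partial}{\partial t^\alpha}-M^{(j)}_{(\beta)\alpha}\frac{\partial}{\partial x^j_\beta},\qquad \frac{\delta}{\delta x^i}=\frac{\partial}{\partial x^i}-N^{(j)}_{(\beta)i}\frac{\partial}{\partial x^j_\beta}.$$ The Cartan canonical connection has the components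 $H^\gamma_{\alpha\beta}$ and $$L^i_{jk}=\tfrac12 g^{im}\Big(\frac{\delta g_{mj}}{\delta x^k}+\frac{\delta g_{mk}}{\delta x^j}-\frac{\delta g_{jk}}{\delta x^m}\Big),\qquad C^{i(\gamma)}_{j(k)}=\tfrac12 g^{im}\Big(\frac{\partial g_{mj}}{\partial x^k_\gamma}+\frac{\partial g_{mk}}{\partial x^j_\gamma}-\frac{\partial g_{jk}}{\partial x^m_\gamma}\Big)$$ (its remaining component $G^k_{j\gamma}=\frac12 g^{ki}\,\delta g_{ij}/\delta t^\gamma$ does not enter below), and its local covariant derivatives of the d-tensors used here are $$D^\alpha_{\beta/\gamma}=\frac{\delta D^\alpha_\beta}{\delta t^\gamma}+D^\mu_\beta H^\alpha_{\mu\gamma}-D^\alpha_\mu H^\mu_{\beta\gamma},\qquad D^i_{j\vert k}=\frac{\delta D^i_j}{\delta x^k}+D^m_jL^i_{mk}-D^i_mL^m_{jk},$$ $$D^{(i)(\beta)}_{(\alpha)(j)}\vert^{(\gamma)}_{(k)}=\frac{\partial D^{(i)(\beta)}_{(\alpha)(j)}}{\partial x^k_\gamma}+D^{(m)(\beta)}_{(\alpha)(j)}C^{i(\gamma)}_{m(k)}-D^{(i)(\beta)}_{(\alpha)(m)}C^{m(\gamma)}_{j(k)},$$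 $$C^{l(\gamma)}_{i(k)\vert j}=\frac{\delta C^{l(\gamma)}_{i(k)}}{\delta x^j}+C^{m(\gamma)}_{i(k)}L^l_{mj}-C^{l(\gamma)}_{m(k)}L^m_{ij}-C^{l(\gamma)}_{i(m)}L^m_{kj}.$$ Consider the torsions $$R^{(m)}_{(\mu)ij}=\frac{\delta N^{(m)}_{(\mu)i}}{\delta x^j}-\frac{\delta N^{(m)}_{(\mu)j}}{\delta x^i},\quad P^{(m)(\beta)}_{(\mu)i(j)}=\frac{\partial N^{(m)}_{(\mu)i}}{\partial x^j_\beta}-\delta^\beta_\mu L^m_{ji},\quad S^{(m)(\alpha)(\beta)}_{(\mu)(i)(j)}=\delta^\alpha_\mu C^{m(\beta)}_{i(j)}-\delta^\beta_\mu C^{m(\alpha)}_{j(i)},$$ and the curvatures $$H^\alpha_{\eta\beta\gamma}=\frac{\partial H^\alpha_{\eta\beta}}{\partial t^\gamma}-\frac{\partial H^\alpha_{\eta\gamma}}{\partial t^\beta}+H^\mu_{\eta\beta}H^\alpha_{\mu\gamma}-H^\mu_{\eta\gamma}H^\alpha_{\mu\beta},$$ $$R^l_{ijk}=\frac{\delta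 L^l_{ij}}{\delta x^k}-\frac{\delta L^l_{ik}}{\delta x^j}+L^m_{ij}L^l_{mk}-L^m_{ik}L^l_{mj}+C^{l(\mu)}_{i(m)}R^{(m)}_{(\mu)jk},$$ $$P^{l\,(\gamma)}_{ij(k)}=\frac{\partial L^l_{ij}}{\partial x^k_\gamma}-C^{l(\gamma)}_{i(k)\vert j}+C^{l(\mu)}_{i(m)}P^{(m)(\gamma)}_{(\mu)j(k)},$$ $$S^{l(\beta)(\gamma)}_{i(j)(k)}=\frac{\partial C^{l(\beta)}_{i(j)}}{\partial x^k_\gamma}-\frac{\partial C^{l(\gamma)}_{i(k)}}{\partial x^j_\beta}+C^{m(\beta)}_{i(j)}C^{l(\gamma)}_{m(k)}-C^{m(\gamma)}_{i(k)}C^{l(\beta)}_{m(j)}.$$ Put $H_{\alpha\beta}=H^\mu_{\alpha\beta\mu}$, $R_{ij}=R^m_{ijm}$, $S^{(\alpha)(\beta)}_{(i)(j)}=S^{m(\beta)(\alpha)}_{i(j)(m)}$, $H=h^{\alpha\beta}H_{\alpha\beta}$, $R=g^{ij}R_{ij}$, $S=h_{\alpha\beta}g^{ij}S^{(\alpha)(\beta)}_{(i)(j)}$,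 and define the partial Einstein d-tensors $$\tilde E_{\alpha\beta}=H_{\alpha\beta}-\tfrac H2h_{\alpha\beta},\qquad \tilde E_{ij}=R_{ij}-\tfrac R2 g_{ij},\qquad \tilde E^{(\alpha)(\beta)}_{(i)(j)}=S^{(\alpha)(\beta)}_{(i)(j)}-\tfrac S2h^{\alpha\beta}g_{ij},$$ with $\tilde E^\alpha_\beta=h^{\alpha\mu}\tilde E_{\mu\beta}$, $\tilde E^i_j=g^{im}\tilde E_{mj}$, $\tilde E^{(i)(\beta)}_{(\alpha)(j)}=g^{im}h_{\alpha\mu}\tilde E^{(\mu)(\beta)}_{(m)(j)}$. Then, at every point and for all values of the free indices, $$\tilde E^\mu_{\beta/\mu}=0,$$ $$\tilde E^m_{i\vert m}=-\Big(R^{(m)}_{(\mu)il}P^{l(\mu)}_{\;(m)}-\tfrac12 g^{kp}R^{(m)}_{(\mu)kl}P^{l\,(\mu)}_{pi(m)}\Big),$$ $$\tilde E^{(m)(\alpha)}_{(\mu)(i)}\vert^{(\mu)}_{(m)}=-\Big(S^{(m)(\alpha)(\delta)}_{(\mu)(i)(l)}S^{(l)(\mu)}_{(\delta)(m)}-\tfrac12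 g^{kp}h_{\delta\gamma}S^{(m)(\gamma)(\delta)}_{(\mu)(k)(l)}S^{l(\alpha)(\mu)}_{p(i)(m)}\Big),$$ where $P^{i(\beta)}_{\;(j)}=g^{lm}P^{i\,(\beta)}_{lm(j)}$ and $S^{(i)(\beta)}_{(\alpha)(j)}=g^{lm}h_{\alpha\mu}S^{i(\mu)(\beta)}_{l(m)(j)}$. -/

import Mathlib

open scoped ContDiff

noncomputable section

/-- Points of an induced coordinate chart of the jet bundle `J¹(T, M)`, with `dim T = p` and
`dim M = n`: triples `(t^α, x^i, x^i_α)`. The last entry is the function `(i, α) ↦ x^i_α`. -/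
abbrev JetPt (p n : ℕ) : Type :=
  (Fin p → ℝ) × (Fin n → ℝ) × (Fin n → Fin p → ℝ)

/-- A generalized metrical multi-time Lagrange space in an induced chart of `J¹(T, M)`: a temporal
semi-Riemannian metric `h_{αβ}(t)`, a symmetric nondegenerate spatial metrical d-tensor
`g_{ij}(t, x, x_α)` (so that the vertical fundamental metrical d-tensor is `h^{αβ} g_{ij}`), and a
spatial nonlinear connection `N^{(i)}_{(α)j}`. The domain is any open set of the chart. -/
structure GMLSpace (p n : ℕ) where
  /-- the temporal coordinate domain -/
  domT : Set (Fin p → ℝ)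
  isOpen_domT : IsOpen domT
  /-- the coordinate domain in the jet space -/
  dom : Set (JetPt p n)
  isOpen_dom : IsOpen dom
  fst_mem : ∀ z ∈ dom, z.1 ∈ domT
  /-- the temporal metric `h_{αβ}(t)` -/
  h : (Fin p → ℝ) → Matrix (Fin p) (Fin p) ℝ
  h_smooth : ∀ α β, ContDiffOn ℝ ∞ (fun t => h t α β) domT
  h_symm : ∀ t ∈ domT, (h t).IsSymm
  h_nondeg : ∀ t ∈ domT, IsUnit (h t).det
  /-- the spatial metrical d-tensor `g_{ij}(t, x, x_α)` -/
  g : JetPt p n → Matrix (Fin n) (Fin n) ℝ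
  g_smooth : ∀ i j, ContDiffOn ℝ ∞ (fun z => g z i j) dom
  g_symm : ∀ z ∈ dom, (g z).IsSymm
  g_nondeg : ∀ z ∈ dom, IsUnit (g z).det
  /-- the spatial nonlinear connection; `N i α j` is `N^{(i)}_{(α)j}` -/
  N : Fin n → Fin p → Fin n → JetPt p n → ℝ
  N_smooth : ∀ i α j, ContDiffOn ℝ ∞ (N i α j) dom

/-- The Kronecker symbol. -/
def kron {k : ℕ} (a b : Fin k) : ℝ := if a = b then 1 else 0

/-- `∂f/∂t^α` -/
def pdT {p n : ℕ} (α : Fin p) (f : JetPt p n → ℝ) (z : JetPt p n) : ℝ :=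
  fderiv ℝ f z (Pi.single α 1, 0, 0)

/-- `∂f/∂x^i` -/
def pdX {p n : ℕ} (i : Fin n) (f : JetPt p n → ℝ) (z : JetPt p n) : ℝ :=
  fderiv ℝ f z (0, Pi.single i 1, 0)

/-- `∂f/∂x^i_α` -/
def pdV {p n : ℕ} (i : Fin n) (α : Fin p) (f : JetPt p n → ℝ) (z : JetPt p n) : ℝ :=
  fderiv ℝ f z (0, 0, Pi.single i (Pi.single α 1))

namespace GMLSpace

variable {p n : ℕ} (G : GMLSpace p n)

/-- `h_{αβ}`, as a function on the jet space -/
def hLow (α β : Fin p) (z : JetPt p n) : ℝ := G.h z.1 α β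

/-- `h^{αβ}` -/
def hUp (α β : Fin p) (z : JetPt p n) : ℝ := (G.h z.1)⁻¹ α β

/-- `g_{ij}` -/
def gLow (i j : Fin n) (z : JetPt p n) : ℝ := G.g z i j

/-- `g^{ij}` -/
def gUp (i j : Fin n) (z : JetPt p n) : ℝ := (G.g z)⁻¹ i j

/-- The Christoffel symbols of the temporal metric; `chrisH γ α β` is `H^γ_{αβ}`. -/
def chrisH (γ α β : Fin p) (z : JetPt p n) : ℝ :=
  1 / 2 * ∑ μ, G.hUp γ μ z *
    (pdT β (G.hLow μ α) z + pdT α (G.hLow μ β) z - pdT μ (G.hLow α β) z)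

/-- The canonical temporal nonlinear connection; `M i α β` is
`M^{(i)}_{(α)β} = - H^γ_{αβ} x^i_γ`. -/
def M (i : Fin n) (α β : Fin p) (z : JetPt p n) : ℝ :=
  -∑ γ, G.chrisH γ α β z * z.2.2 i γ

/-- The adapted derivative `δ/δt^α = ∂/∂t^α - M^{(j)}_{(β)α} ∂/∂x^j_β`. -/
def deltaT (α : Fin p) (f : JetPt p n → ℝ) (z : JetPt p n) : ℝ :=
  pdT α f z - ∑ j, ∑ β, G.M j β α z * pdV j β f z

/-- The adapted derivative `δ/δx^i = ∂/∂x^i - N^{(j)}_{(β)i} ∂/∂x^j_β`. -/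
def deltaX (i : Fin n) (f : JetPt p n → ℝ) (z : JetPt p n) : ℝ :=
  pdX i f z - ∑ j, ∑ β, G.N j β i z * pdV j β f z

/-! ### The Cartan canonical connection

The components of the connection that enter below are `H^γ_{αβ}` (see `chrisH`), `L^i_{jk}` and
`C^{i(γ)}_{j(k)}`. -/

/-- `cartanL i j k` is `L^i_{jk}`. -/
def cartanL (i j k : Fin n) (z : JetPt p n) : ℝ :=
  1 / 2 * ∑ m, G.gUp i m z *
    (G.deltaX k (G.gLow m j) z + G.deltaX j (G.gLow m k) z - G.deltaX m (G.gLow j k) z)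

/-- `cartanC i j k γ` is `C^{i(γ)}_{j(k)}`. -/
def cartanC (i j k : Fin n) (γ : Fin p) (z : JetPt p n) : ℝ :=
  1 / 2 * ∑ m, G.gUp i m z *
    (pdV k γ (G.gLow m j) z + pdV j γ (G.gLow m k) z - pdV m γ (G.gLow j k) z)

/-! ### Local covariant derivatives

The connection is `h`-normal: its vertical components are
`δ^β_α L^k_{ij}` and `δ^β_α C^{k(γ)}_{i(j)}`, so Greek indices are not affected by the spatial and
the vertical covariant derivatives. -/

/-- `covT D α β γ` is `D^α_{β/γ}`, for a d-tensor `D^α_β`. -/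
def covT (D : Fin p → Fin p → JetPt p n → ℝ) (α β γ : Fin p) (z : JetPt p n) : ℝ :=
  G.deltaT γ (D α β) z + ∑ μ, D μ β z * G.chrisH α μ γ z - ∑ μ, D α μ z * G.chrisH μ β γ z

/-- `covX D i j k` is `D^i_{j|k}`, for a d-tensor `D^i_j`. -/
def covX (D : Fin n → Fin n → JetPt p n → ℝ) (i j k : Fin n) (z : JetPt p n) : ℝ :=
  G.deltaX k (D i j) z + ∑ m, D m j z * G.cartanL i m k z - ∑ m, D i m z * G.cartanL m j k z

/-- `covV D i α j β k γ` is `D^{(i)(β)}_{(α)(j)}|^{(γ)}_{(k)}`, for a d-tensor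
`D^{(i)(β)}_{(α)(j)}`, entered as `D i α j β`. -/
def covV (D : Fin n → Fin p → Fin n → Fin p → JetPt p n → ℝ)
    (i : Fin n) (α : Fin p) (j : Fin n) (β : Fin p) (k : Fin n) (γ : Fin p)
    (z : JetPt p n) : ℝ :=
  pdV k γ (D i α j β) z + ∑ m, D m α j β z * G.cartanC i m k γ z
    - ∑ m, D i α m β z * G.cartanC m j k γ z

/-- `covXC l i k γ j` is `C^{l(γ)}_{i(k)|j}`. -/
def covXC (l i k : Fin n) (γ : Fin p) (j : Fin n) (z : JetPt p n) : ℝ :=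
  G.deltaX j (G.cartanC l i k γ) z + ∑ m, G.cartanC m i k γ z * G.cartanL l m j z
    - ∑ m, G.cartanC l m k γ z * G.cartanL m i j z
    - ∑ m, G.cartanC l i m γ z * G.cartanL m k j z

/-! ### Torsion components -/

/-- `torR m μ i j` is `R^{(m)}_{(μ)ij} = δN^{(m)}_{(μ)i}/δx^j - δN^{(m)}_{(μ)j}/δx^i`. -/
def torR (m : Fin n) (μ : Fin p) (i j : Fin n) (z : JetPt p n) : ℝ :=
  G.deltaX j (G.N m μ i) z - G.deltaX i (G.N m μ j) z

/-- `torP m μ i j β` is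
`P^{(m)(β)}_{(μ)i(j)} = ∂N^{(m)}_{(μ)i}/∂x^j_β - δ^β_μ L^m_{ji}`. -/
def torP (m : Fin n) (μ : Fin p) (i j : Fin n) (β : Fin p) (z : JetPt p n) : ℝ :=
  pdV j β (G.N m μ i) z - kron β μ * G.cartanL m j i z

/-- `torS m μ i α j β` is
`S^{(m)(α)(β)}_{(μ)(i)(j)} = δ^α_μ C^{m(β)}_{i(j)} - δ^β_μ C^{m(α)}_{j(i)}`. -/
def torS (m : Fin n) (μ : Fin p) (i : Fin n) (α : Fin p) (j : Fin n) (β : Fin p)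
    (z : JetPt p n) : ℝ :=
  kron α μ * G.cartanC m i j β z - kron β μ * G.cartanC m j i α z

/-! ### Curvature components -/

/-- `curvH α η β γ` is `H^α_{ηβγ}`. -/
def curvH (α η β γ : Fin p) (z : JetPt p n) : ℝ :=
  pdT γ (G.chrisH α η β) z - pdT β (G.chrisH α η γ) z
    + ∑ μ, (G.chrisH μ η β z * G.chrisH α μ γ z - G.chrisH μ η γ z * G.chrisH α μ β z)

/-- `curvR l i j k` is `R^l_{ijk}`. -/
def curvR (l i j k : Fin n) (z : JetPt p n) : ℝ :=
  G.deltaX k (G.cartanL l i j) z - G.deltaX j (G.cartanL l i k) z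
    + ∑ m, (G.cartanL m i j z * G.cartanL l m k z - G.cartanL m i k z * G.cartanL l m j z)
    + ∑ m, ∑ μ, G.cartanC l i m μ z * G.torR m μ j k z

/-- `curvP l i j k γ` is `P^{l(γ)}_{ij(k)}`. -/
def curvP (l i j k : Fin n) (γ : Fin p) (z : JetPt p n) : ℝ :=
  pdV k γ (G.cartanL l i j) z - G.covXC l i k γ j z
    + ∑ m, ∑ μ, G.cartanC l i m μ z * G.torP m μ j k γ z

/-- `curvS l i j β k γ` is `S^{l(β)(γ)}_{i(j)(k)}`. -/
def curvS (l i j : Fin n) (β : Fin p) (k : Fin n) (γ : Fin p) (z : JetPt p n) : ℝ :=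
  pdV k γ (G.cartanC l i j β) z - pdV j β (G.cartanC l i k γ) z
    + ∑ m, (G.cartanC m i j β z * G.cartanC l m k γ z - G.cartanC m i k γ z * G.cartanC l m j β z)

/-- `curvPmix i j β` is `P^{i(β)}_{(j)} = g^{lm} P^{i(β)}_{lm(j)}`. -/
def curvPmix (i j : Fin n) (β : Fin p) (z : JetPt p n) : ℝ :=
  ∑ l, ∑ m, G.gUp l m z * G.curvP i l m j β z

/-- `curvSmix i α j β` is `S^{(i)(β)}_{(α)(j)} = g^{lm} h_{αμ} S^{i(μ)(β)}_{l(m)(j)}`. -/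
def curvSmix (i : Fin n) (α : Fin p) (j : Fin n) (β : Fin p) (z : JetPt p n) : ℝ :=
  ∑ l, ∑ m, ∑ μ, G.gUp l m z * G.hLow α μ z * G.curvS i l m μ j β z

/-! ### Ricci components and partial scalar curvatures -/

/-- `H_{αβ} = H^μ_{αβμ}` -/
def ricH (α β : Fin p) (z : JetPt p n) : ℝ := ∑ μ, G.curvH μ α β μ z

/-- `R_{ij} = R^m_{ijm}` -/
def ricR (i j : Fin n) (z : JetPt p n) : ℝ := ∑ m, G.curvR m i j m z

/-- `ricS i α j β` is `S^{(α)(β)}_{(i)(j)} = S^{m(β)(α)}_{i(j)(m)}`. -/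
def ricS (i : Fin n) (α : Fin p) (j : Fin n) (β : Fin p) (z : JetPt p n) : ℝ :=
  ∑ m, G.curvS m i j β m α z

/-- `H = h^{αβ} H_{αβ}` -/
def scalH (z : JetPt p n) : ℝ := ∑ α, ∑ β, G.hUp α β z * G.ricH α β z

/-- `R = g^{ij} R_{ij}` -/
def scalR (z : JetPt p n) : ℝ := ∑ i, ∑ j, G.gUp i j z * G.ricR i j z

/-- `S = h_{αβ} g^{ij} S^{(α)(β)}_{(i)(j)}` -/
def scalS (z : JetPt p n) : ℝ :=
  ∑ α, ∑ β, ∑ i, ∑ j, G.hLow α β z * G.gUp i j z * G.ricS i α j β z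

/-! ### Partial Einstein d-tensors -/

/-- `Ẽ_{αβ} = H_{αβ} - (H/2) h_{αβ}` -/
def einT (α β : Fin p) (z : JetPt p n) : ℝ :=
  G.ricH α β z - G.scalH z / 2 * G.hLow α β z

/-- `Ẽ_{ij} = R_{ij} - (R/2) g_{ij}` -/
def einX (i j : Fin n) (z : JetPt p n) : ℝ :=
  G.ricR i j z - G.scalR z / 2 * G.gLow i j z

/-- `einV i α j β` is `Ẽ^{(α)(β)}_{(i)(j)} = S^{(α)(β)}_{(i)(j)} - (S/2) h^{αβ} g_{ij}`. -/
def einV (i : Fin n) (α : Fin p) (j : Fin n) (β : Fin p) (z : JetPt p n) : ℝ :=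
  G.ricS i α j β z - G.scalS z / 2 * G.hUp α β z * G.gLow i j z

/-- `Ẽ^α_β = h^{αμ} Ẽ_{μβ}` -/
def einTmix (α β : Fin p) (z : JetPt p n) : ℝ := ∑ μ, G.hUp α μ z * G.einT μ β z

/-- `Ẽ^i_j = g^{im} Ẽ_{mj}` -/
def einXmix (i j : Fin n) (z : JetPt p n) : ℝ := ∑ m, G.gUp i m z * G.einX m j z

/-- `einVmix i α j β` is `Ẽ^{(i)(β)}_{(α)(j)} = g^{im} h_{αμ} Ẽ^{(μ)(β)}_{(m)(j)}`. -/
def einVmix (i : Fin n) (α : Fin p) (j : Fin n) (β : Fin p) (z : JetPt p n) : ℝ :=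
  ∑ m, ∑ μ, G.gUp i m z * G.hLow α μ z * G.einV m μ j β z

end GMLSpace

end

/-! All three identities are instances of one algebraic statement, the contracted second Bianchi
identity for a metric connection along derivations `D` of a commutative algebra. The brackets of the
`D` need not vanish: they lie in the span of auxiliary derivations `V`, with coefficients `T`.
Writing ∇ for the derivations corrected by the connection matrices, the curvature is Ω(a,b) = [∇_b,
∇_a] - ∇_[D_b, D_a], and P(c,e) is the same expression for one `D` and one `V`. The Jacobi identity
makes the cyclic sum of ∇_c Ω(a,b) + T_ab P(c) vanish (`MetricFrame.bianchi`). Differentiating the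
direction indices covariantly as well brings in the torsion of the connection, so that the error
terms become `EinsteinFrame.U`.

Since the connection is metric, Ω and P are skew-adjoint, and contraction with the inverse metric
and with `h` commutes with covariant differentiation. Contracting twice, one cyclic term gives the
derivative of the scalar curvature and the other two each give minus the divergence of the Ricci
tensor (`contracted_bianchi`). The trace part of the Einstein tensor absorbs the derivative of the
scalar curvature, and only contractions of `U` remain (`div_einMix`).

The algebra is that of smooth functions on the chart domain, and the connection matrices are
Christoffel symbols, which are metric for any family of derivations. Temporal case: `D` = ∂/∂t
commute and the symbols are symmetric, so `U` = 0. Spatial case: `D` = δ/δx and `V` = ∂/∂x^i_α; the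
symbols are again symmetric, but `T` is the torsion R of the nonlinear connection, which leaves R
times P. Vertical case: `D` = ∂/∂x^i_α commute, but each symbol is formed with a single Greek index,
so the connection has torsion S, which leaves S times the curvature S. It remains to match the
algebraic expressions with the coordinate formulas. -/

open scoped Matrix

/-! ### Derivations acting entrywise on matrices -/

namespace Matrix

variable {A l m n : Type*} [CommRing A] [Algebra ℝ A]

theorem map_derivation_mul [Fintype m] (X : Derivation ℝ A A) (M : Matrix l m A)
    (N : Matrix m n A) : (M * N).map X = M.map X * N + M * N.map X := by
  ext i j
  simp only [Matrix.map_apply, Matrix.mul_apply, Matrix.add_apply, map_sum, Derivation.leibniz,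
    smul_eq_mul, ← Finset.sum_add_distrib]
  exact Finset.sum_congr rfl fun _ _ => by ring

theorem map_derivation_add (X : Derivation ℝ A A) (M N : Matrix l m A) :
    (M + N).map X = M.map X + N.map X := by
  ext i j; simp

theorem map_derivation_sub (X : Derivation ℝ A A) (M N : Matrix l m A) :
    (M - N).map X = M.map X - N.map X := by
  ext i j; simp

theorem map_derivation_smul (X : Derivation ℝ A A) (r : A) (M : Matrix l m A) :
    (r • M).map X = X r • M + r • M.map X := by
  ext i j
  simp only [Matrix.map_apply, Matrix.smul_apply, Matrix.add_apply, Derivation.leibniz,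
    smul_eq_mul]
  ring

theorem map_derivation_sum {κ : Type*} (s : Finset κ) (X : Derivation ℝ A A)
    (M : κ → Matrix l m A) : (∑ e ∈ s, M e).map X = ∑ e ∈ s, (M e).map X := by
  ext i j; simp [Matrix.sum_apply]

/-- The curvature matrix of a metric connection is skew-adjoint. -/
theorem curvature_skew [Fintype n] (X Y : Derivation ℝ A A) {g Γ η Ψ : Matrix n n A}
    (hX : g.map X = g * Γ + Γᵀ * g) (hY : g.map Y = g * η + ηᵀ * g)
    (hXY : (g.map Y).map X - (g.map X).map Y = g * Ψ + Ψᵀ * g) :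
    g * (Γ.map Y - η.map X + η * Γ - Γ * η + Ψ)
      + (Γ.map Y - η.map X + η * Γ - Γ * η + Ψ)ᵀ * g = 0 := by
  have e : ∀ (Z : Derivation ℝ A A) (M : Matrix n n A), Mᵀ.map Z = (M.map Z)ᵀ := fun _ _ => rfl
  rw [hX, hY] at hXY
  simp only [map_derivation_add, map_derivation_mul, e, hX, hY] at hXY
  simp only [Matrix.transpose_add, Matrix.transpose_sub, Matrix.transpose_mul]
  rw [← sub_eq_zero] at hXY
  -- Once the first derivatives of the metric are eliminated, the asserted sum is minus the
  -- difference of the two sides of the commutator relation.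
  rw [← neg_eq_zero, ← hXY]
  noncomm_ring

end Matrix

/-! ### Metric connections and the second Bianchi identity -/

/-- A family of derivations `D`, `V` of an algebra with brackets `[D, D]`, `[D, V]` in the span of
the `V`, and metric connection matrices `Γ`, `Θ` along them. -/
structure MetricFrame (A ι κ E : Type*) [CommRing A] [Algebra ℝ A] [Fintype ι] [Fintype E] where
  D : ι × κ → Derivation ℝ A A
  V : E → Derivation ℝ A A
  g : Matrix ι ι A
  Γ : ι × κ → Matrix ι ι A
  Θ : E → Matrix ι ι A
  T : ι × κ → ι × κ → E → A
  K : ι × κ → E → E → A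
  compatD : ∀ a, g.map (D a) = g * Γ a + (Γ a)ᵀ * g
  compatV : ∀ e, g.map (V e) = g * Θ e + (Θ e)ᵀ * g
  commDD : ∀ a b f, D a (D b f) - D b (D a f) = ∑ e, T a b e * V e f
  commDV : ∀ c e f, D c (V e f) - V e (D c f) = ∑ e', K c e e' * V e' f
  jacobi : ∀ a b c e, (D c (T a b e) + ∑ f, T a b f * K c f e)
    + (D a (T b c e) + ∑ f, T b c f * K a f e) + (D b (T c a e) + ∑ f, T c a f * K b f e) = 0

namespace MetricFrame

open Matrix

variable {A ι κ E : Type*} [CommRing A] [Algebra ℝ A] [Fintype ι] [Fintype E]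
  (F : MetricFrame A ι κ E)

/-- The curvature along two directions `D`. -/
def Ω (a b : ι × κ) : Matrix ι ι A :=
  (F.Γ a).map (F.D b) - (F.Γ b).map (F.D a) + F.Γ b * F.Γ a - F.Γ a * F.Γ b
    + ∑ e, F.T a b e • F.Θ e

/-- The curvature along a direction `D` and a direction `V`. -/
def P (c : ι × κ) (e : E) : Matrix ι ι A :=
  (F.Γ c).map (F.V e) - (F.Θ e).map (F.D c) + F.Θ e * F.Γ c - F.Γ c * F.Θ e
    + ∑ f, F.K c e f • F.Θ f

/-- The covariant derivative of an endomorphism along `D c`. -/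
def nabla (c : ι × κ) (X : Matrix ι ι A) : Matrix ι ι A :=
  X.map (F.D c) + F.Γ c * X - X * F.Γ c

theorem commDD_map (a b : ι × κ) (M : Matrix ι ι A) :
    (M.map (F.D b)).map (F.D a) - (M.map (F.D a)).map (F.D b) =
      ∑ e, F.T a b e • M.map (F.V e) := by
  ext i j
  simpa [Matrix.sum_apply] using F.commDD a b (M i j)

theorem commDV_map (c : ι × κ) (e : E) (M : Matrix ι ι A) :
    (M.map (F.V e)).map (F.D c) - (M.map (F.D c)).map (F.V e) =
      ∑ f, F.K c e f • M.map (F.V f) := by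
  ext i j
  simpa [Matrix.sum_apply] using F.commDV c e (M i j)

theorem metric_sum (r : E → A) :
    ∑ e, r e • F.g.map (F.V e) = F.g * (∑ e, r e • F.Θ e) + (∑ e, r e • F.Θ e)ᵀ * F.g := by
  simp only [F.compatV, Matrix.transpose_sum, Matrix.transpose_smul, Finset.mul_sum,
    Finset.sum_mul, ← Finset.sum_add_distrib, smul_add, Matrix.mul_smul, Matrix.smul_mul]

theorem Ω_skew (a b : ι × κ) : F.g * F.Ω a b + (F.Ω a b)ᵀ * F.g = 0 :=
  curvature_skew _ _ (F.compatD a) (F.compatD b) (by rw [F.commDD_map, F.metric_sum])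

theorem P_skew (c : ι × κ) (e : E) : F.g * F.P c e + (F.P c e)ᵀ * F.g = 0 :=
  curvature_skew _ _ (F.compatD c) (F.compatV e) (by rw [F.commDV_map, F.metric_sum])

/-- `nabla c` of the curvature plus the torsion term, with the second derivatives isolated. -/
theorem nabla_Ω (a b c : ι × κ) :
    F.nabla c (F.Ω a b) + ∑ e, F.T a b e • F.P c e =
      ((F.Γ a).map (F.D b)).map (F.D c) - ((F.Γ b).map (F.D a)).map (F.D c)
      + ((F.Γ b).map (F.D c) * F.Γ a + F.Γ b * (F.Γ a).map (F.D c)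
      - (F.Γ a).map (F.D c) * F.Γ b - F.Γ a * (F.Γ b).map (F.D c))
      + (F.Γ c * ((F.Γ a).map (F.D b) - (F.Γ b).map (F.D a) + F.Γ b * F.Γ a - F.Γ a * F.Γ b)
      - ((F.Γ a).map (F.D b) - (F.Γ b).map (F.D a) + F.Γ b * F.Γ a - F.Γ a * F.Γ b) * F.Γ c)
      + ∑ e, F.T a b e • (F.Γ c).map (F.V e)
      + ∑ e, (F.D c (F.T a b e) + ∑ f, F.T a b f * F.K c f e) • F.Θ e := by
  have h1 : ∑ e, (∑ f, F.T a b f * F.K c f e) • F.Θ e =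
      ∑ e, F.T a b e • ∑ f, F.K c e f • F.Θ f := by
    simp only [Finset.sum_smul, Finset.smul_sum, smul_smul]
    exact Finset.sum_comm
  simp only [add_smul, Finset.sum_add_distrib, h1]
  -- The terms of `nabla` in which Θ is differentiated along `D c` or commuted with `Γ c` cancel
  -- against those of `P`; Θ survives only undifferentiated, with the coefficient occurring in
  -- `jacobi`.
  simp only [nabla, Ω, P, map_derivation_add, map_derivation_sub, map_derivation_mul,
    map_derivation_sum, map_derivation_smul, smul_add, smul_sub, Finset.sum_add_distrib,
    Finset.sum_sub_distrib, mul_add, add_mul, Finset.mul_sum, Finset.sum_mul, Matrix.mul_smul,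
    Matrix.smul_mul, mul_sub, sub_mul]
  abel

/-- The second Bianchi identity. -/
theorem bianchi (a b c : ι × κ) :
    (F.nabla c (F.Ω a b) + ∑ e, F.T a b e • F.P c e)
    + (F.nabla a (F.Ω b c) + ∑ e, F.T b c e • F.P a e)
    + (F.nabla b (F.Ω c a) + ∑ e, F.T c a e • F.P b e) = 0 := by
  rw [F.nabla_Ω, F.nabla_Ω, F.nabla_Ω]
  have h1 := F.commDD_map a b (F.Γ c)
  have h2 := F.commDD_map b c (F.Γ a)
  have h3 := F.commDD_map c a (F.Γ b)
  have h4 : ∑ e, (F.D c (F.T a b e) + ∑ f, F.T a b f * F.K c f e) • F.Θ e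
      + ∑ e, (F.D a (F.T b c e) + ∑ f, F.T b c f * F.K a f e) • F.Θ e
      + ∑ e, (F.D b (F.T c a e) + ∑ f, F.T c a f * F.K b f e) • F.Θ e = 0 := by
    simp only [← Finset.sum_add_distrib, ← add_smul, F.jacobi, zero_smul, Finset.sum_const_zero]
  -- The terms T V(Γ) become commutators of second derivatives, which cancel cyclically; the last
  -- rewrite replaces the 0 on the right by the Jacobi sum of the Θ terms.
  rw [← h1, ← h2, ← h3, ← h4]
  noncomm_ring

end MetricFrame

/-! ### Skewness, covariant derivatives and contractions -/

/-- A `MetricFrame` with the inverse of its metric and with a second metric, constant along the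
derivations `D`, on the index type `κ`. -/
structure EinsteinFrame (A ι κ E : Type*) [CommRing A] [Algebra ℝ A] [Fintype ι] [DecidableEq ι]
    [Fintype κ] [DecidableEq κ] [Fintype E] extends MetricFrame A ι κ E where
  ginv : Matrix ι ι A
  g_symm : gᵀ = g
  ginv_mul : ginv * g = 1
  h : Matrix κ κ A
  hinv : Matrix κ κ A
  h_symm : hᵀ = h
  h_mul : h * hinv = 1
  h_const : ∀ a α β, D a (h α β) = 0

namespace EinsteinFrame

open MetricFrame Matrix

variable {A ι κ E : Type*} [CommRing A] [Algebra ℝ A] [Fintype ι] [DecidableEq ι] [Fintype κ]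
  [DecidableEq κ] [Fintype E] (F : EinsteinFrame A ι κ E)

theorem ginv_symm : F.ginvᵀ = F.ginv := by
  have h1 : F.g * F.ginv = 1 := mul_eq_one_comm.mp F.ginv_mul
  have h2 : F.ginvᵀ * F.g = 1 := by
    have h3 := congrArg Matrix.transpose h1
    rwa [Matrix.transpose_mul, F.g_symm, Matrix.transpose_one] at h3
  exact left_inv_eq_right_inv h2 h1

theorem ginv_comm (i j : ι) : F.ginv i j = F.ginv j i := congrFun₂ F.ginv_symm j i

theorem h_comm (α β : κ) : F.h α β = F.h β α := congrFun₂ F.h_symm β α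

/-- `M` becomes skew-symmetric when its lower index is raised. -/
def Skew (M : Matrix ι ι A) : Prop := M * F.ginv + F.ginv * Mᵀ = 0

theorem skew_of_metric {M : Matrix ι ι A} (hM : F.g * M + Mᵀ * F.g = 0) : F.Skew M := by
  have h1 : F.g * F.ginv = 1 := mul_eq_one_comm.mp F.ginv_mul
  have : F.ginv * (F.g * M + Mᵀ * F.g) * F.ginv = M * F.ginv + F.ginv * Mᵀ := by
    simp only [mul_add, add_mul, ← mul_assoc, F.ginv_mul, one_mul]
    rw [mul_assoc _ F.g, h1, mul_one]
  rw [Skew, ← this, hM, mul_zero, zero_mul]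

variable {F} in
theorem Skew.apply {M : Matrix ι ι A} (hM : F.Skew M) (l j : ι) :
    ∑ i, F.ginv j i * M l i = -∑ i, F.ginv l i * M j i := by
  have := congrFun₂ hM l j
  simp only [Matrix.add_apply, Matrix.mul_apply, Matrix.transpose_apply, Matrix.zero_apply] at this
  rw [← add_eq_zero_iff_eq_neg, ← this]
  congr 1
  exact Finset.sum_congr rfl fun i _ => by rw [F.ginv_comm, mul_comm]

variable {F} in
theorem Skew.add {M N : Matrix ι ι A} (hM : F.Skew M) (hN : F.Skew N) : F.Skew (M + N) := by
  unfold Skew at *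
  rw [Matrix.transpose_add, add_mul, mul_add, add_add_add_comm, hM, hN, add_zero]

variable {F} in
theorem Skew.smul {M : Matrix ι ι A} (r : A) (hM : F.Skew M) : F.Skew (r • M) := by
  unfold Skew at *
  rw [Matrix.transpose_smul, Matrix.smul_mul, Matrix.mul_smul, ← smul_add, hM, smul_zero]

variable {F} in
theorem Skew.sum {η : Type*} {s : Finset η} {M : η → Matrix ι ι A} (hM : ∀ e, F.Skew (M e)) :
    F.Skew (∑ e ∈ s, M e) := by
  unfold Skew at *
  rw [Matrix.transpose_sum, Finset.sum_mul, Finset.mul_sum, ← Finset.sum_add_distrib]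
  exact Finset.sum_eq_zero fun e _ => hM e

variable {F} in
theorem Skew.sub {M N : Matrix ι ι A} (hM : F.Skew M) (hN : F.Skew N) : F.Skew (M - N) := by
  have := hM.add (hN.smul (-1))
  rwa [neg_one_smul, ← sub_eq_add_neg] at this

/-- The inverse metric is parallel: differentiate `ginv * g = 1` and use metricity. -/
theorem ginv_map (c : ι × κ) :
    F.ginv.map (F.D c) = -(F.Γ c * F.ginv) - F.ginv * (F.Γ c)ᵀ := by
  have h1 : F.g * F.ginv = 1 := mul_eq_one_comm.mp F.ginv_mul
  have h2 : (F.ginv * F.g).map (F.D c) = 0 := by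
    rw [F.ginv_mul]
    ext i j
    by_cases hij : i = j <;> simp [hij]
  rw [map_derivation_mul, F.compatD] at h2
  have h3 := congrArg (· * F.ginv) h2
  simp only [zero_mul, add_mul, mul_add, mul_assoc, h1, mul_one] at h3
  rw [← mul_assoc F.ginv F.g, F.ginv_mul, one_mul] at h3
  rw [eq_sub_iff_add_eq, eq_neg_iff_add_eq_zero, ← h3]
  abel

variable {F} in
-- Because the inverse metric is parallel, the skewness condition may be differentiated covariantly:
-- its plain derivative is corrected by `Γ c` on the left and `(Γ c)ᵀ` on the right.
theorem Skew.nabla {M : Matrix ι ι A} (hM : F.Skew M) (c : ι × κ) :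
    F.Skew (F.nabla c M) := by
  have h1 := congrArg (fun N => N.map (F.D c)) hM
  have h2 := congrArg (F.Γ c * ·) hM
  have h3 := congrArg (· * (F.Γ c)ᵀ) hM
  have e : Mᵀ.map (F.D c) = (M.map (F.D c))ᵀ := rfl
  have e0 : (0 : Matrix ι ι A).map (F.D c) = 0 := by ext; simp
  simp only [map_derivation_add, map_derivation_mul, F.ginv_map, e, e0] at h1
  simp only [mul_zero, zero_mul] at h2 h3
  have h4 := congrArg₂ (· + ·) h1 (congrArg₂ (· + ·) h2 h3)
  simp only [add_zero] at h4
  rw [Skew, MetricFrame.nabla, ← h4]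
  simp only [Matrix.transpose_add, Matrix.transpose_sub, Matrix.transpose_mul]
  noncomm_ring

/-- Covariant derivative of a tensor with two lower indices. -/
def covLow (c : ι × κ) (Y : ι → ι → A) (i j : ι) : A :=
  F.D c (Y i j) - ∑ s, F.Γ c s i * Y s j - ∑ s, F.Γ c s j * Y i s

/-- Covariant derivative of a tensor with one upper and one lower index. -/
def covMix (c : ι × κ) (Y : ι → ι → A) (i j : ι) : A :=
  F.D c (Y i j) + ∑ s, Y s j * F.Γ c i s - ∑ s, Y i s * F.Γ c s j

/-- Covariant derivative of an endomorphism-valued tensor with two lower indices. -/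
def covEnd (c : ι × κ) (X : ι → ι → Matrix ι ι A) (j k : ι) : Matrix ι ι A :=
  F.nabla c (X j k) - ∑ s, F.Γ c s j • X s k - ∑ s, F.Γ c s k • X j s

/-- In the contraction of the upper index with the second direction, the two connection terms
cancel. -/
theorem trace_covEnd (c : ι × κ) (X : ι → ι → Matrix ι ι A) (i j : ι) :
    ∑ l, F.covEnd c X j l l i = F.covLow c (fun i j => ∑ l, X j l l i) i j := by
  simp only [covEnd, MetricFrame.nabla, covLow, Matrix.sub_apply, Matrix.add_apply,
    Matrix.sum_apply, Matrix.smul_apply, Matrix.mul_apply, Matrix.map_apply, smul_eq_mul,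
    Finset.sum_sub_distrib, Finset.sum_add_distrib, map_sum, Finset.mul_sum]
  have h1 : ∑ l, ∑ s, F.Γ c s l * X j s l i = ∑ l, ∑ s, F.Γ c l s * X j l s i :=
    Finset.sum_comm
  have h2 : ∑ l, ∑ s, X j l l s * F.Γ c s i = ∑ s, ∑ l, F.Γ c s i * X j l l s := by
    rw [Finset.sum_comm]; simp only [mul_comm]
  have h3 : ∑ l, ∑ s, F.Γ c s j * X s l l i = ∑ s, ∑ l, F.Γ c s j * X s l l i :=
    Finset.sum_comm
  rw [h1, h2, h3]
  abel

/-- Raising an index commutes with covariant differentiation because `ginv` is parallel. -/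
theorem raise_covLow (c : ι × κ) (Y : ι → ι → A) (a j : ι) :
    ∑ s, F.ginv a s * F.covLow c Y s j =
      F.covMix c (fun a j => ∑ s, F.ginv a s * Y s j) a j := by
  have h0 : ∀ s, F.D c (F.ginv a s) =
      -(∑ x, F.Γ c a x * F.ginv x s) - ∑ x, F.ginv a x * F.Γ c s x := fun s =>
    congrFun₂ (F.ginv_map c) a s
  simp only [covLow, covMix, map_sum, Derivation.leibniz, smul_eq_mul, h0, mul_sub,
    mul_neg, Finset.sum_add_distrib, Finset.sum_sub_distrib, Finset.sum_neg_distrib,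
    Finset.mul_sum, Finset.sum_mul]
  have h1 : ∑ s, ∑ x, Y s j * (F.Γ c a x * F.ginv x s) =
      ∑ x, ∑ s, F.ginv x s * Y s j * F.Γ c a x := by
    rw [Finset.sum_comm]
    exact Finset.sum_congr rfl fun _ _ => Finset.sum_congr rfl fun _ _ => by ring
  have h2 : ∑ s, ∑ x, Y s j * (F.ginv a x * F.Γ c s x) =
      ∑ x, ∑ s, F.ginv a x * (F.Γ c s x * Y s j) := by
    rw [Finset.sum_comm]
    exact Finset.sum_congr rfl fun _ _ => Finset.sum_congr rfl fun _ _ => by ring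
  have h3 : ∑ s, ∑ x, F.ginv a s * (F.Γ c x j * Y s x) =
      ∑ x, ∑ s, F.ginv a s * Y s x * F.Γ c x j := by
    rw [Finset.sum_comm]
    exact Finset.sum_congr rfl fun _ _ => Finset.sum_congr rfl fun _ _ => by ring
  rw [h1, h2, h3]
  ring

theorem trace_covMix (c : ι × κ) (Y : ι → ι → A) :
    ∑ a, F.covMix c Y a a = F.D c (∑ a, Y a a) := by
  simp only [covMix, Finset.sum_add_distrib, Finset.sum_sub_distrib, map_sum]
  rw [Finset.sum_comm (f := fun a s => Y s a * F.Γ c a s), add_sub_cancel_right]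

/-- The connection does not act on indices in `κ`, so the constancy of `h` along `D` suffices. -/
theorem covMix_sum_h (c : ι × κ) (β : κ) (Y : κ → ι → ι → A) (a j : ι) :
    ∑ γ, F.h β γ * F.covMix c (Y γ) a j =
      F.covMix c (fun a j => ∑ γ, F.h β γ * Y γ a j) a j := by
  simp only [covMix, map_sum, Derivation.leibniz, F.h_const, smul_eq_mul, mul_zero, add_zero,
    mul_sub, mul_add, Finset.sum_add_distrib, Finset.sum_sub_distrib, Finset.mul_sum,
    Finset.sum_mul]
  congr 1
  · congr 1
    rw [Finset.sum_comm]; simp only [mul_assoc]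
  · rw [Finset.sum_comm]; simp only [mul_assoc]

variable {F} in
theorem Skew.covEnd {X : ι → ι → Matrix ι ι A} (hX : ∀ j k, F.Skew (X j k)) (c : ι × κ)
    (j k : ι) : F.Skew (F.covEnd c X j k) :=
  (((hX j k).nabla c).sub (Skew.sum fun s => (hX s k).smul _)).sub
    (Skew.sum fun s => (hX j s).smul _)

/-- The torsion of the connection acting on the first component of the index of `D`. -/
def tor (a b s : ι × κ) : A :=
  (if a.2 = s.2 then 1 else 0) * F.Γ b s.1 a.1 - (if b.2 = s.2 then 1 else 0) * F.Γ a s.1 b.1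

/-- The torsion terms in the second Bianchi identity. -/
def U (a b c : ι × κ) : Matrix ι ι A :=
  ∑ e, F.T a b e • F.P c e + ∑ s, F.tor a b s • F.Ω c s

/-- The covariant derivative of the curvature. -/
def covΩ (c a b : ι × κ) : Matrix ι ι A :=
  F.covEnd c (fun j k => F.Ω (j, a.2) (k, b.2)) a.1 b.1

end EinsteinFrame

/-! ### The contracted Bianchi identity and the divergence of the Einstein tensor -/

namespace EinsteinFrame

open MetricFrame Matrix

variable {A ι κ E : Type*} [CommRing A] [Algebra ℝ A] [Fintype ι] [DecidableEq ι] [Fintype κ]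
  [DecidableEq κ] [Fintype E] (F : EinsteinFrame A ι κ E)

theorem Ω_swap (hT : ∀ a b e, F.T b a e = -F.T a b e) (a b : ι × κ) :
    F.Ω b a = -F.Ω a b := by
  have : ∑ e, F.T b a e • F.Θ e = -∑ e, F.T a b e • F.Θ e := by
    rw [← Finset.sum_neg_distrib]
    exact Finset.sum_congr rfl fun e _ => by rw [hT, neg_smul]
  simp only [MetricFrame.Ω, this]
  abel

theorem skew_Ω (a b : ι × κ) : F.Skew (F.Ω a b) := F.skew_of_metric (F.Ω_skew a b)

theorem skew_P (c : ι × κ) (e : E) : F.Skew (F.P c e) := F.skew_of_metric (F.P_skew c e)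

theorem skew_U (a b c : ι × κ) : F.Skew (F.U a b c) :=
  (Skew.sum fun e => (F.skew_P c e).smul _).add (Skew.sum fun s => (F.skew_Ω c s).smul _)

theorem skew_covΩ (c a b : ι × κ) : F.Skew (F.covΩ c a b) :=
  Skew.covEnd (fun _ _ => F.skew_Ω _ _) c _ _

theorem sum_tor (a b : ι × κ) (M : ι × κ → Matrix ι ι A) :
    ∑ s, F.tor a b s • M s =
      ∑ s, F.Γ b s a.1 • M (s, a.2) - ∑ s, F.Γ a s b.1 • M (s, b.2) := by
  simp only [tor, sub_smul, Finset.sum_sub_distrib, Fintype.sum_prod_type, ite_mul, one_mul,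
    zero_mul, ite_smul, zero_smul, Finset.sum_ite_eq, Finset.mem_univ, if_true]

/-- Differentiating the direction indices adds terms Γ Ω to `nabla`; over a cyclic sum they pair, by
antisymmetry of Ω, into minus the torsion terms of `U`. -/
theorem bianchi_cov (hT : ∀ a b e, F.T b a e = -F.T a b e) (a b c : ι × κ) :
    (F.covΩ c a b + F.U a b c) + (F.covΩ a b c + F.U b c a) + (F.covΩ b c a + F.U c a b) = 0 := by
  have hΩ : ∀ a b, F.Ω a b = -F.Ω b a := fun a b => F.Ω_swap hT b a
  have key : ∀ a b c : ι × κ, F.covΩ c a b = F.nabla c (F.Ω a b)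
      + ∑ s, F.Γ c s a.1 • F.Ω b (s, a.2) - ∑ s, F.Γ c s b.1 • F.Ω a (s, b.2) := by
    intro a b c
    have : ∑ s, F.Γ c s a.1 • F.Ω b (s, a.2) = -∑ s, F.Γ c s a.1 • F.Ω (s, a.2) b := by
      rw [← Finset.sum_neg_distrib]
      exact Finset.sum_congr rfl fun s _ => by rw [hΩ, smul_neg]
    rw [this, ← sub_eq_add_neg]
    rfl
  simp only [key, U, sum_tor]
  rw [← F.bianchi a b c]
  abel

/-- The Ricci tensor. -/
def ric (i : ι) (α : κ) (j : ι) (β : κ) : A := ∑ m, F.Ω (j, β) (m, α) m i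

/-- The Ricci tensor with the first spatial index raised. -/
def ricUp (α β : κ) (a j : ι) : A := ∑ s, F.ginv a s * F.ric s α j β

/-- The scalar curvature. -/
def scal : A := ∑ α, ∑ β, ∑ i, ∑ j, F.h α β * F.ginv i j * F.ric i α j β

/-- The Ricci tensor in mixed form. -/
def ricMix (m : ι) (μ : κ) (i : ι) (α : κ) : A := ∑ γ, F.h μ γ * F.ricUp γ α m i

theorem scal_eq : F.scal = ∑ β, ∑ γ, F.h β γ * ∑ j, F.ricUp γ β j j := by
  simp only [scal, ricUp, Finset.mul_sum]
  rw [Finset.sum_comm]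
  refine Finset.sum_congr rfl fun β _ => Finset.sum_congr rfl fun γ _ => ?_
  rw [Finset.sum_comm]
  refine Finset.sum_congr rfl fun j _ => Finset.sum_congr rfl fun i _ => ?_
  rw [F.h_comm, F.ginv_comm]
  ring

/-- Full contraction of an endomorphism-valued tensor depending on two directions. -/
def contract (M : ι × κ → ι × κ → Matrix ι ι A) : A :=
  ∑ β, ∑ γ, F.h β γ * ∑ j, ∑ i, F.ginv j i * ∑ l, M (j, β) (l, γ) l i

theorem contract_add (M N : ι × κ → ι × κ → Matrix ι ι A) :
    F.contract (fun a b => M a b + N a b) = F.contract M + F.contract N := by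
  simp only [contract, Matrix.add_apply, Finset.sum_add_distrib, mul_add]

theorem contract_neg (M : ι × κ → ι × κ → Matrix ι ι A) :
    F.contract (fun a b => -M a b) = -F.contract M := by
  simp only [contract, Matrix.neg_apply, Finset.sum_neg_distrib, mul_neg]

theorem contract_zero : F.contract (fun _ _ => 0) = 0 := by
  simp [contract]

/-- Skewness exchanges the two indices contracted with the directions at the cost of a sign;
renaming the sums, with `h` symmetric, turns this into an exchange of the directions. -/
theorem contract_swap {M : ι × κ → ι × κ → Matrix ι ι A} (hM : ∀ a b, F.Skew (M a b)) :
    F.contract M = -F.contract (fun a b => M b a) := by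
  have h1 : ∀ β γ, ∑ j, ∑ i, F.ginv j i * ∑ l, M (j, β) (l, γ) l i =
      -∑ j, ∑ i, F.ginv j i * ∑ l, M (l, β) (j, γ) l i := by
    intro β γ
    simp only [Finset.mul_sum]
    have h2 : ∀ j, ∑ i, ∑ l, F.ginv j i * M (j, β) (l, γ) l i =
        -∑ l, ∑ i, F.ginv l i * M (j, β) (l, γ) j i := by
      intro j
      rw [Finset.sum_comm, ← Finset.sum_neg_distrib]
      exact Finset.sum_congr rfl fun l _ => (hM _ _).apply l j
    simp only [h2, Finset.sum_neg_distrib]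
    rw [Finset.sum_comm]
    congr 1
    exact Finset.sum_congr rfl fun l _ => Finset.sum_comm
  simp only [contract, h1, mul_neg, Finset.sum_neg_distrib]
  rw [Finset.sum_comm]
  congr 1
  refine Finset.sum_congr rfl fun β _ => Finset.sum_congr rfl fun γ _ => ?_
  rw [F.h_comm]

/-- The metric, its inverse and `h` are parallel, so the derivative passes through the full
contraction. -/
theorem D_scal (c : ι × κ) : F.D c F.scal = F.contract (F.covΩ c) := by
  simp only [contract, covΩ, trace_covEnd]
  simp only [scal_eq, map_sum, Derivation.leibniz, F.h_const, smul_eq_mul, mul_zero, add_zero]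
  refine Finset.sum_congr rfl fun β _ => Finset.sum_congr rfl fun γ _ => ?_
  congr 1
  have h1 : ∀ j, ∑ i, F.ginv j i *
      F.covLow c (fun i j => ∑ l, F.Ω (j, β) (l, γ) l i) i j =
      F.covMix c (F.ricUp γ β) j j := fun j => F.raise_covLow c _ j j
  simp only [h1, trace_covMix, map_sum]

theorem div_ricMix (c : ι × κ) :
    ∑ β, ∑ j, F.covMix (j, β) (fun a i => F.ricMix a β i c.2) j c.1 =
      F.contract (fun a b => F.covΩ a c b) := by
  simp only [contract, covΩ, trace_covEnd]
  refine Finset.sum_congr rfl fun β _ => ?_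
  have h1 : ∀ γ j, ∑ i, F.ginv j i *
      F.covLow (j, β) (fun i j => ∑ l, F.Ω (j, c.2) (l, γ) l i) i c.1 =
      F.covMix (j, β) (F.ricUp γ c.2) j c.1 := fun γ j => F.raise_covLow (j, β) _ j c.1
  simp only [h1, Finset.mul_sum]
  rw [Finset.sum_comm]
  exact Finset.sum_congr rfl fun j _ => (F.covMix_sum_h (j, β) β _ j c.1).symm

theorem covΩ_swap (hT : ∀ a b e, F.T b a e = -F.T a b e) (c a b : ι × κ) :
    F.covΩ c b a = -F.covΩ c a b := by
  have hneg : F.nabla c (F.Ω b a) = -F.nabla c (F.Ω a b) := by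
    have : (-F.Ω a b).map (F.D c) = -(F.Ω a b).map (F.D c) := by ext; simp
    rw [F.Ω_swap hT a b, MetricFrame.nabla, MetricFrame.nabla, this]
    noncomm_ring
  have h1 : ∑ s, F.Γ c s b.1 • F.Ω (s, b.2) a = -∑ s, F.Γ c s b.1 • F.Ω a (s, b.2) := by
    rw [← Finset.sum_neg_distrib]
    exact Finset.sum_congr rfl fun s _ => by rw [F.Ω_swap hT a, smul_neg]
  have h2 : ∑ s, F.Γ c s a.1 • F.Ω b (s, a.2) = -∑ s, F.Γ c s a.1 • F.Ω (s, a.2) b := by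
    rw [← Finset.sum_neg_distrib]
    exact Finset.sum_congr rfl fun s _ => by rw [F.Ω_swap hT _ b, smul_neg]
  change F.nabla c (F.Ω b a) - ∑ s, F.Γ c s b.1 • F.Ω (s, b.2) a
    - ∑ s, F.Γ c s a.1 • F.Ω b (s, a.2) = -(F.nabla c (F.Ω a b)
    - ∑ s, F.Γ c s a.1 • F.Ω (s, a.2) b - ∑ s, F.Γ c s b.1 • F.Ω a (s, b.2))
  rw [hneg, h1, h2]
  abel

theorem U_swap (hT : ∀ a b e, F.T b a e = -F.T a b e) (a b c : ι × κ) :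
    F.U b a c = -F.U a b c := by
  have htor : ∀ s, F.tor b a s = -F.tor a b s := fun s => by unfold tor; ring
  simp only [U, hT a b, htor, neg_smul, Finset.sum_neg_distrib, neg_add]

/-- The contracted second Bianchi identity. -/
theorem contracted_bianchi (hT : ∀ a b e, F.T b a e = -F.T a b e) (c : ι × κ) :
    F.D c F.scal =
      (2 : ℝ) • ∑ β, ∑ j, F.covMix (j, β) (fun a i => F.ricMix a β i c.2) j c.1
      + (2 : ℝ) • F.contract (fun a b => F.U c b a) - F.contract (fun a b => F.U a b c) := by
  have h0 : F.contract (fun a b => (F.covΩ c a b + F.U a b c) + (F.covΩ a b c + F.U b c a)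
      + (F.covΩ b c a + F.U c a b)) = 0 := by
    simp only [F.bianchi_cov hT, contract_zero]
  -- The other two cyclic terms both reduce to the divergence of the Ricci tensor, one by
  -- antisymmetry in the directions and the other by `contract_swap`; this is the source of the
  -- factor 2. The `U` terms behave alike.
  have h1 : F.contract (fun a b => F.covΩ a b c) = -F.contract (fun a b => F.covΩ a c b) := by
    simp only [fun a b => F.covΩ_swap hT a c b, contract_neg]
  have h2 : F.contract (fun a b => F.covΩ b c a) = -F.contract (fun a b => F.covΩ a c b) :=
    F.contract_swap fun _ _ => F.skew_covΩ _ _ _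
  have h3 : F.contract (fun a b => F.U b c a) = -F.contract (fun a b => F.U c b a) := by
    simp only [fun a b => F.U_swap hT c b a, contract_neg]
  have h4 : F.contract (fun a b => F.U c a b) = -F.contract (fun a b => F.U c b a) :=
    F.contract_swap fun _ _ => F.skew_U _ _ _
  rw [F.contract_add (fun a b => (F.covΩ c a b + F.U a b c) + (F.covΩ a b c + F.U b c a)),
    F.contract_add (fun a b => F.covΩ c a b + F.U a b c), F.contract_add (fun a b => F.covΩ c a b),
    F.contract_add (fun a b => F.covΩ a b c), F.contract_add (fun a b => F.covΩ b c a),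
    h1, h2, h3, h4, ← F.div_ricMix] at h0
  rw [D_scal, two_smul, two_smul]
  linear_combination h0

/-- The Einstein tensor. -/
noncomputable def ein (i : ι) (α : κ) (j : ι) (β : κ) : A :=
  F.ric i α j β - ((1 / 2 : ℝ) • F.scal) * F.hinv α β * F.g i j

/-- The Einstein tensor in mixed form. -/
noncomputable def einMix (i : ι) (α : κ) (j : ι) (β : κ) : A :=
  ∑ m, ∑ μ, F.ginv i m * F.h α μ * F.ein m μ j β

theorem einMix_eq (i : ι) (α : κ) (j : ι) (β : κ) :
    F.einMix i α j β = F.ricMix i α j β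
      - (if i = j then if α = β then (1 / 2 : ℝ) • F.scal else 0 else 0) := by
  have h1 : ∑ m, F.ginv i m * F.g m j = if i = j then 1 else 0 := by
    rw [← Matrix.one_apply, ← F.ginv_mul, Matrix.mul_apply]
  have h2 : ∑ μ, F.h α μ * F.hinv μ β = if α = β then 1 else 0 := by
    rw [← Matrix.one_apply, ← F.h_mul, Matrix.mul_apply]
  have h3 : ∑ m, ∑ μ, F.ginv i m * F.h α μ * (((1 / 2 : ℝ) • F.scal) * F.hinv μ β * F.g m j) =
      ((1 / 2 : ℝ) • F.scal) * ((∑ m, F.ginv i m * F.g m j) * ∑ μ, F.h α μ * F.hinv μ β) := by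
    simp only [Finset.sum_mul, Finset.mul_sum]
    rw [Finset.sum_comm]
    exact Finset.sum_congr rfl fun m _ => Finset.sum_congr rfl fun μ _ => by ring
  simp only [einMix, ein, mul_sub, Finset.sum_sub_distrib, h3, h1, h2]
  congr 1
  · simp only [ricMix, ricUp, Finset.mul_sum]
    rw [Finset.sum_comm]
    exact Finset.sum_congr rfl fun m _ => Finset.sum_congr rfl fun μ _ => by ring
  · split_ifs <;> simp

/-- Half of the contracted Bianchi identity: the derivative of the scalar curvature cancels against
the divergence of the trace part. -/
theorem div_einMix (hT : ∀ a b e, F.T b a e = -F.T a b e) (c : ι × κ) :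
    ∑ m, ∑ μ, F.covMix (m, μ) (fun a i => F.einMix a μ i c.2) m c.1 =
      -(F.contract (fun a b => F.U c b a)
        - (1 / 2 : ℝ) • F.contract (fun a b => F.U a b c)) := by
  obtain ⟨i, α⟩ := c
  have hcov : ∀ m μ, F.covMix (m, μ) (fun a i => F.einMix a μ i α) m i =
      F.covMix (m, μ) (fun a i => F.ricMix a μ i α) m i -
      F.covMix (m, μ)
        (fun a i => if a = i then if μ = α then (1 / 2 : ℝ) • F.scal else 0 else 0) m i := by
    intro m μ
    simp only [covMix, einMix_eq, map_sub, sub_mul, Finset.sum_sub_distrib]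
    ring
  -- The Kronecker tensor is parallel, so only its scalar coefficient is differentiated.
  have hid : ∀ m μ, F.covMix (m, μ)
      (fun a i => if a = i then if μ = α then (1 / 2 : ℝ) • F.scal else 0 else 0) m i =
      if m = i then if μ = α then (1 / 2 : ℝ) • F.D (i, α) F.scal else 0 else 0 := by
    intro m μ
    simp only [covMix, ite_mul, zero_mul, Finset.sum_ite_eq, Finset.sum_ite_eq', Finset.mem_univ,
      if_true]
    by_cases hm : m = i
    · by_cases hμ : μ = α
      · subst hm hμ; simp
      · simp [hm, hμ]
    · by_cases hμ : μ = α <;> simp [hm, hμ]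
  simp only [hcov, hid, Finset.sum_sub_distrib]
  simp only [Finset.sum_ite_irrel, Finset.sum_const_zero, Finset.sum_ite_eq', Finset.mem_univ,
    if_true]
  rw [F.contracted_bianchi hT (i, α), Finset.sum_comm]
  module

end EinsteinFrame

/-! ### Christoffel symbols for an arbitrary family of derivations -/

section Christoffel

open Matrix

variable {A ι : Type*} [CommRing A] [Algebra ℝ A] [Fintype ι]

/-- The Christoffel symbols of a metric with respect to a family of derivations, as matrices
indexed by the direction of derivation. -/
noncomputable def christoffel (X : ι → Derivation ℝ A A) (g ginv : Matrix ι ι A) (k : ι) :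
    Matrix ι ι A := fun i j =>
  (1 / 2 : ℝ) • ∑ m, ginv i m * (X k (g m j) + X j (g m k) - X m (g j k))

theorem christoffel_symm (X : ι → Derivation ℝ A A) {g : Matrix ι ι A} (ginv : Matrix ι ι A)
    (hg : gᵀ = g) (i j k : ι) : christoffel X g ginv k i j = christoffel X g ginv j i k := by
  have hs : g j k = g k j := congrFun₂ hg k j
  simp only [christoffel, hs]
  congr 1
  exact Finset.sum_congr rfl fun m _ => by ring

/-- Lowering the upper index leaves three derivatives of the metric; symmetrizing in the remaining
pair keeps only the one along `X k`. The derivations need not commute. -/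
theorem christoffel_compat [DecidableEq ι] (X : ι → Derivation ℝ A A) {g ginv : Matrix ι ι A} (hg : gᵀ = g)
    (hinv : ginv * g = 1) (k : ι) :
    g.map (X k) = g * christoffel X g ginv k + (christoffel X g ginv k)ᵀ * g := by
  have hs : ∀ a b, g a b = g b a := fun a b => congrFun₂ hg b a
  have h1 : g * ginv = 1 := mul_eq_one_comm.mp hinv
  have h2 : ∀ i j, (g * christoffel X g ginv k) i j =
      (1 / 2 : ℝ) • (X k (g i j) + X j (g i k) - X i (g j k)) := by
    intro i j
    have h3 : christoffel X g ginv k =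
        (1 / 2 : ℝ) • (ginv * Matrix.of fun m j => X k (g m j) + X j (g m k) - X m (g j k)) := by
      ext i j
      simp [christoffel, Matrix.mul_apply]
    rw [h3, Matrix.mul_smul, ← mul_assoc, h1, one_mul]
    simp
  ext i j
  have h4 : ((christoffel X g ginv k)ᵀ * g) i j = (g * christoffel X g ginv k) j i := by
    rw [← Matrix.transpose_apply (g * _), Matrix.transpose_mul, hg]
  rw [Matrix.add_apply, h4, h2, h2, Matrix.map_apply, hs j i, hs j k, hs i k]
  module

end Christoffel

/-! ### The algebra of smooth functions on an open set -/

open TopologicalSpace (Opens)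

variable {W : Type*} [NormedAddCommGroup W] [NormedSpace ℝ W]

/-- The algebra of smooth functions on an open set of a normed space. -/
def smoothFn (U : Opens W) : Subalgebra ℝ (U → ℝ) where
  carrier := {f | ∃ F : W → ℝ, ContDiffOn ℝ ∞ F U ∧ ∀ z : U, f z = F z}
  mul_mem' := by
    rintro f g ⟨F, hF, hf⟩ ⟨F', hF', hg⟩
    exact ⟨fun z => F z * F' z, hF.mul hF', fun z => by simp [hf, hg]⟩
  add_mem' := by
    rintro f g ⟨F, hF, hf⟩ ⟨F', hF', hg⟩
    exact ⟨fun z => F z + F' z, hF.add hF', fun z => by simp [hf, hg]⟩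
  algebraMap_mem' r := ⟨fun _ => r, contDiffOn_const, fun z => by simp⟩

namespace smoothFn

variable {U : Opens W}

/-- Evaluation at a point. -/
def ev (z : U) : smoothFn U →ₐ[ℝ] ℝ :=
  (Pi.evalAlgHom ℝ (fun _ : U => ℝ) z).comp (smoothFn U).val

theorem ext_ev {f g : smoothFn U} (h : ∀ z, ev z f = ev z g) : f = g :=
  Subtype.ext (funext h)

/-- The function `F` restricts to `f` on `U`. -/
def Rep (f : smoothFn U) (F : W → ℝ) : Prop := ∀ z : U, ev z f = F z

/-- The restriction of a function that is smooth on `U`. -/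
def ofFun (F : W → ℝ) (hF : ContDiffOn ℝ ∞ F U) : smoothFn U := ⟨fun z => F z, F, hF, fun _ => rfl⟩

theorem rep_ofFun (F : W → ℝ) (hF : ContDiffOn ℝ ∞ F U) : Rep (ofFun F hF) F := fun _ => rfl

theorem exists_rep (f : smoothFn U) : ∃ F : W → ℝ, ContDiffOn ℝ ∞ F U ∧ Rep f F := f.2

/-- A function on the whole space that restricts to `f`. -/
noncomputable def extend (f : smoothFn U) : W → ℝ := (exists_rep f).choose

theorem contDiffOn_extend (f : smoothFn U) : ContDiffOn ℝ ∞ (extend f) U :=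
  (exists_rep f).choose_spec.1

theorem rep_extend (f : smoothFn U) : Rep f (extend f) := (exists_rep f).choose_spec.2

theorem Rep.eqOn {f : smoothFn U} {F F' : W → ℝ} (h : Rep f F) (h' : Rep f F') : Set.EqOn F F' U :=
  fun z hz => (h ⟨z, hz⟩).symm.trans (h' ⟨z, hz⟩)

theorem Rep.contDiffOn {f : smoothFn U} {F : W → ℝ} (h : Rep f F) : ContDiffOn ℝ ∞ F U :=
  (contDiffOn_extend f).congr (h.eqOn (rep_extend f))

theorem Rep.differentiableAt {f : smoothFn U} {F : W → ℝ} (h : Rep f F) (z : U) :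
    DifferentiableAt ℝ F z :=
  (h.contDiffOn.contDiffAt (U.isOpen.mem_nhds z.2)).differentiableAt (by simp)

/-- Since `U` is open, the derivative at its points does not depend on the chosen extension. This
lets coordinate expressions be differentiated in place of the arbitrary `extend f`. -/
theorem Rep.fderiv_eq {f : smoothFn U} {F F' : W → ℝ} (h : Rep f F) (h' : Rep f F') (z : U) :
    fderiv ℝ F z = fderiv ℝ F' z :=
  ((h.eqOn h').eventuallyEq_of_mem (U.isOpen.mem_nhds z.2)).fderiv_eq

theorem Rep.mul {f g : smoothFn U} {F F' : W → ℝ} (hf : Rep f F) (hg : Rep g F') :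
    Rep (f * g) (fun z => F z * F' z) := fun z => by rw [map_mul, hf z, hg z]

theorem Rep.add {f g : smoothFn U} {F F' : W → ℝ} (hf : Rep f F) (hg : Rep g F') :
    Rep (f + g) (fun z => F z + F' z) := fun z => by rw [map_add, hf z, hg z]

theorem Rep.smul (r : ℝ) {f : smoothFn U} {F : W → ℝ} (hf : Rep f F) :
    Rep (r • f) (fun z => r * F z) := fun z => by rw [map_smul, hf z, smul_eq_mul]

/-- The directional derivative. -/
noncomputable def dirFun (v : W) (f : smoothFn U) : smoothFn U :=
  ofFun (fun z => fderiv ℝ (extend f) z v)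
    (((contDiffOn_extend f).fderiv_of_isOpen U.isOpen (by simp)).clm_apply contDiffOn_const)

theorem Rep.dirFun {f : smoothFn U} {F : W → ℝ} (h : Rep f F) (v : W) (z : U) :
    ev z (dirFun v f) = fderiv ℝ F z v := by
  rw [← (rep_extend f).fderiv_eq h]
  rfl

/-- The directional derivative, as a derivation. -/
noncomputable def dir (v : W) : Derivation ℝ (smoothFn U) (smoothFn U) :=
  Derivation.mk'
    { toFun := dirFun v
      map_add' := fun f g => ext_ev fun z => by
        rw [map_add, ((rep_extend f).add (rep_extend g)).dirFun, (rep_extend f).dirFun,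
          (rep_extend g).dirFun, fderiv_fun_add ((rep_extend f).differentiableAt z)
            ((rep_extend g).differentiableAt z)]
        rfl
      map_smul' := fun r f => ext_ev fun z => by
        rw [RingHom.id_apply, map_smul, ((rep_extend f).smul r).dirFun, (rep_extend f).dirFun,
          fderiv_const_mul ((rep_extend f).differentiableAt z)]
        rfl }
    fun f g => ext_ev fun z => by
      simp only [LinearMap.coe_mk, AddHom.coe_mk, smul_eq_mul, map_add, map_mul]
      rw [((rep_extend f).mul (rep_extend g)).dirFun, (rep_extend f).dirFun, (rep_extend g).dirFun,
        fderiv_fun_mul ((rep_extend f).differentiableAt z) ((rep_extend g).differentiableAt z),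
        (rep_extend f) z, (rep_extend g) z]
      simp

theorem Rep.dir {f : smoothFn U} {F : W → ℝ} (h : Rep f F) (v : W) :
    Rep (dir v f) (fun z => fderiv ℝ F z v) := h.dirFun v

theorem dir_comm (v w : W) (f : smoothFn U) : dir v (dir w f) = dir w (dir v f) := by
  have hd : ∀ z : U, DifferentiableAt ℝ (fderiv ℝ (extend f)) z := fun z =>
    (((contDiffOn_extend f).fderiv_of_isOpen U.isOpen (m := ∞) (by simp)).contDiffAt
      (U.isOpen.mem_nhds z.2)).differentiableAt (by simp)
  have h1 : ∀ (v w : W) (z : U), ev z (dir v (dir w f)) = fderiv ℝ (fderiv ℝ (extend f)) z v w := by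
    intro v w z
    rw [((rep_extend f).dir w).dir v z]
    beta_reduce
    rw [fderiv_clm_apply (hd z) (differentiableAt_const w)]
    simp
  refine ext_ev fun z => ?_
  rw [h1, h1]
  exact (((contDiffOn_extend f).contDiffAt (U.isOpen.mem_nhds z.2)).isSymmSndFDerivAt
    (by rw [minSmoothness_of_isRCLikeNormedField]; exact WithTop.coe_le_coe.mpr le_top)).eq v w

theorem isUnit_of_forall_ne_zero {f : smoothFn U} (h : ∀ z, ev z f ≠ 0) : IsUnit f := by
  have hF : ∀ z ∈ (U : Set W), (extend f) z ≠ 0 := fun z hz => by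
    rw [← (rep_extend f) ⟨z, hz⟩]; exact h _
  refine IsUnit.of_mul_eq_one (ofFun _ ((contDiffOn_extend f).inv hF)) (ext_ev fun z => ?_)
  rw [map_mul, map_one, (rep_extend f) z, rep_ofFun _ _ z]
  exact mul_inv_cancel₀ (hF z z.2)

variable {ι : Type*} [Fintype ι] [DecidableEq ι]

/-- Pointwise nondegeneracy suffices because the reciprocal of a nowhere zero smooth function is
smooth; `M⁻¹` is then a genuine inverse over the algebra. -/
theorem isUnit_det {M : Matrix ι ι (smoothFn U)} (h : ∀ z, IsUnit (M.map (ev z)).det) :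
    IsUnit M.det := by
  refine isUnit_of_forall_ne_zero fun z => ?_
  have := (h z).ne_zero
  rwa [← AlgHom.coe_toRingHom, ← RingHom.mapMatrix_apply, ← RingHom.map_det] at this

theorem ev_inv {M : Matrix ι ι (smoothFn U)} (h : IsUnit M.det) (z : U) :
    (M⁻¹).map (ev z) = (M.map (ev z))⁻¹ := by
  refine (Matrix.inv_eq_left_inv ?_).symm
  rw [← AlgHom.coe_toRingHom, ← Matrix.map_mul, Matrix.nonsing_inv_mul M h]
  simp

end smoothFn

noncomputable section

/-! ### Brackets of derivations adapted to a nonlinear connection -/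

section Adapted

variable {A ι E : Type*} [CommRing A] [Algebra ℝ A] [Fintype E]

/-- The derivations `X i` corrected by the coefficients `N` of a nonlinear connection. -/
def adapted (X : ι → Derivation ℝ A A) (V : E → Derivation ℝ A A) (N : E → ι → A) (i : ι) :
    Derivation ℝ A A := X i - ∑ e, N e i • V e

variable (X : ι → Derivation ℝ A A) (V : E → Derivation ℝ A A) (N : E → ι → A)

theorem adapted_apply (i : ι) (f : A) : adapted X V N i f = X i f - ∑ e, N e i * V e f := by
  have : (∑ e, N e i • V e) f = ∑ e, N e i * V e f := by
    have h := congrFun (map_sum (Derivation.coeFnAddMonoidHom (R := ℝ) (A := A) (M := A))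
      (fun e => N e i • V e) Finset.univ) f
    rw [Finset.sum_apply] at h
    exact h
  rw [adapted, Derivation.sub_apply, this]

variable {X V}

/-- All second derivatives of `f` cancel because `X` and `V` commute; only derivatives of the
coefficients `N` remain. -/
theorem adapted_comm (hX : ∀ i j f, X i (X j f) = X j (X i f))
    (hXV : ∀ i e f, X i (V e f) = V e (X i f)) (hV : ∀ e e' f, V e (V e' f) = V e' (V e f))
    (a b : ι) (f : A) :
    adapted X V N a (adapted X V N b f) - adapted X V N b (adapted X V N a f) =
      ∑ e, (adapted X V N b (N e a) - adapted X V N a (N e b)) * V e f := by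
  have h1 : ∀ a b, adapted X V N a (adapted X V N b f) = X a (X b f)
      - ∑ e, N e a * X b (V e f) - ∑ e, N e b * X a (V e f)
      + ∑ e, ∑ e', N e b * N e' a * V e' (V e f)
      - ∑ e, adapted X V N a (N e b) * V e f := by
    intro a b
    rw [adapted_apply X V N b, map_sub, map_sum]
    simp only [Derivation.leibniz, smul_eq_mul, adapted_apply X V N a (X b f),
      adapted_apply X V N a (V _ f), Finset.sum_add_distrib, mul_sub, Finset.sum_sub_distrib,
      Finset.mul_sum, hXV, mul_comm (V _ f), mul_assoc]
    ring
  have h2 : ∑ e, ∑ e', N e b * N e' a * V e' (V e f) =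
      ∑ e, ∑ e', N e a * N e' b * V e' (V e f) := by
    rw [Finset.sum_comm]
    exact Finset.sum_congr rfl fun e _ => Finset.sum_congr rfl fun e' _ => by
      rw [hV, mul_comm (N e' b)]
  rw [h1, h1, h2, hX a b]
  simp only [sub_mul, Finset.sum_sub_distrib]
  ring

theorem adapted_comm_vert (hXV : ∀ i e f, X i (V e f) = V e (X i f))
    (hV : ∀ e e' f, V e (V e' f) = V e' (V e f)) (c : ι) (e : E) (f : A) :
    adapted X V N c (V e f) - V e (adapted X V N c f) = ∑ e', V e (N e' c) * V e' f := by
  rw [adapted_apply, adapted_apply, map_sub, map_sum]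
  simp only [Derivation.leibniz, smul_eq_mul, Finset.sum_add_distrib, hXV, mul_comm (V _ f), hV e]
  ring

/-- By `adapted_comm`, each inner sum is a commutator of adapted derivatives applied to a
coefficient of `N`; the second derivatives of the coefficients then cancel in the cyclic sum. -/
theorem adapted_jacobi (hX : ∀ i j f, X i (X j f) = X j (X i f))
    (hXV : ∀ i e f, X i (V e f) = V e (X i f)) (hV : ∀ e e' f, V e (V e' f) = V e' (V e f))
    {δ : ι → Derivation ℝ A A} (hδ : δ = adapted X V N) (a b c : ι) (e : E) :
    (δ c (δ b (N e a) - δ a (N e b)) + ∑ f, (δ b (N f a) - δ a (N f b)) * V f (N e c))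
    + (δ a (δ c (N e b) - δ b (N e c)) + ∑ f, (δ c (N f b) - δ b (N f c)) * V f (N e a))
    + (δ b (δ a (N e c) - δ c (N e a)) + ∑ f, (δ a (N f c) - δ c (N f a)) * V f (N e b)) = 0 := by
  subst hδ
  simp only [← adapted_comm N hX hXV hV, map_sub]
  ring

end Adapted

/-! ### The temporal, spatial and vertical frames -/

namespace GMLSpace

open smoothFn Matrix

variable {p n : ℕ} (G : GMLSpace p n)

/-- The domain of the space. -/
def U : TopologicalSpace.Opens (JetPt p n) := ⟨G.dom, G.isOpen_dom⟩

/-- The smooth functions on the domain. -/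
abbrev Fn : Type := smoothFn G.U

/-- `∂/∂t^α` -/
def dT (α : Fin p) : Derivation ℝ G.Fn G.Fn := dir (Pi.single α 1, 0, 0)

/-- `∂/∂x^i` -/
def dX (i : Fin n) : Derivation ℝ G.Fn G.Fn := dir (0, Pi.single i 1, 0)

/-- `∂/∂x^i_α` -/
def dV (e : Fin n × Fin p) : Derivation ℝ G.Fn G.Fn := dir (0, 0, Pi.single e.1 (Pi.single e.2 1))

/-- `g_{ij}` -/
def gA : Matrix (Fin n) (Fin n) G.Fn := fun i j => ofFun (G.gLow i j) (G.g_smooth i j)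

/-- `h_{αβ}` -/
def hA : Matrix (Fin p) (Fin p) G.Fn := fun α β => ofFun (G.hLow α β)
  ((G.h_smooth α β).comp contDiff_fst.contDiffOn G.fst_mem)

/-- `N^{(i)}_{(α)j}`, with `e = (i, α)` -/
def NA (e : Fin n × Fin p) (j : Fin n) : G.Fn := ofFun (G.N e.1 e.2 j) (G.N_smooth e.1 e.2 j)

/-- `δ/δx^i` -/
def dδ (i : Fin n) : Derivation ℝ G.Fn G.Fn := adapted G.dX G.dV G.NA i

theorem gA_map (z : G.U) : G.gA.map (ev z) = G.g z := rfl

theorem hA_map (z : G.U) : G.hA.map (ev z) = G.h z.1.1 := rfl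

theorem isUnit_det_gA : IsUnit G.gA.det := isUnit_det fun z => by
  rw [gA_map]; exact G.g_nondeg z z.2

theorem isUnit_det_hA : IsUnit G.hA.det := isUnit_det fun z => by
  rw [hA_map]; exact G.h_nondeg _ (G.fst_mem z z.2)

theorem gA_symm : G.gAᵀ = G.gA := by
  refine Matrix.ext fun i j => ext_ev (U := G.U) fun z => ?_
  exact (congrFun₂ (G.g_symm z.1 z.2) i j : G.g z.1 j i = G.g z.1 i j)

theorem hA_symm : G.hAᵀ = G.hA := by
  refine Matrix.ext fun i j => ext_ev (U := G.U) fun z => ?_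
  exact (congrFun₂ (G.h_symm _ (G.fst_mem z z.2)) i j : G.h z.1.1 j i = G.h z.1.1 i j)

theorem rep_gLow (i j : Fin n) : Rep (G.gA i j) (G.gLow i j) := fun _ => rfl

theorem rep_hLow (α β : Fin p) : Rep (G.hA α β) (G.hLow α β) := fun _ => rfl

theorem rep_N (i : Fin n) (α : Fin p) (j : Fin n) : Rep (G.NA (i, α) j) (G.N i α j) := fun _ => rfl

theorem rep_gUp (i j : Fin n) : Rep (G.gA⁻¹ i j) (G.gUp i j) := fun z => by
  have := congrFun₂ (ev_inv G.isUnit_det_gA z) i j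
  rwa [gA_map] at this

theorem rep_hUp (α β : Fin p) : Rep (G.hA⁻¹ α β) (G.hUp α β) := fun z => by
  have := congrFun₂ (ev_inv G.isUnit_det_hA z) α β
  rwa [hA_map] at this

variable {G}

theorem _root_.smoothFn.Rep.pdT {f : G.Fn} {F : JetPt p n → ℝ} (h : Rep f F) (α : Fin p) :
    Rep (G.dT α f) (pdT α F) := h.dir _

theorem _root_.smoothFn.Rep.pdX {f : G.Fn} {F : JetPt p n → ℝ} (h : Rep f F) (i : Fin n) :
    Rep (G.dX i f) (pdX i F) := h.dir _

theorem _root_.smoothFn.Rep.pdV {f : G.Fn} {F : JetPt p n → ℝ} (h : Rep f F) (i : Fin n)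
    (α : Fin p) : Rep (G.dV (i, α) f) (pdV i α F) := h.dir _

theorem _root_.smoothFn.Rep.deltaX {f : G.Fn} {F : JetPt p n → ℝ} (h : Rep f F) (i : Fin n) :
    Rep (G.dδ i f) (G.deltaX i F) := fun z => by
  rw [dδ, adapted_apply, map_sub, map_sum, Fintype.sum_prod_type, h.pdX i z]
  simp only [map_mul, h.pdV _ _ z, G.rep_N _ _ _ z]
  rfl

variable (G)

theorem dX_comm (i j : Fin n) (f : G.Fn) : G.dX i (G.dX j f) = G.dX j (G.dX i f) := dir_comm _ _ _

theorem dX_dV (i : Fin n) (e : Fin n × Fin p) (f : G.Fn) :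
    G.dX i (G.dV e f) = G.dV e (G.dX i f) := dir_comm _ _ _

theorem dV_comm (e e' : Fin n × Fin p) (f : G.Fn) : G.dV e (G.dV e' f) = G.dV e' (G.dV e f) :=
  dir_comm _ _ _

/-- The geometry of the temporal metric. -/
def timeFrame : EinsteinFrame G.Fn (Fin p) Unit Empty where
  D a := G.dT a.1
  V := nofun
  g := G.hA
  Γ a := christoffel G.dT G.hA G.hA⁻¹ a.1
  Θ := nofun
  T := fun _ _ => nofun
  K := fun _ => nofun
  compatD a := christoffel_compat _ G.hA_symm (nonsing_inv_mul _ G.isUnit_det_hA) a.1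
  compatV := nofun
  commDD a b f := by
    rw [dT, dT, dir_comm, sub_self, Fintype.sum_empty]
  commDV := fun _ => nofun
  jacobi := fun _ _ _ => nofun
  ginv := G.hA⁻¹
  g_symm := G.hA_symm
  ginv_mul := nonsing_inv_mul _ G.isUnit_det_hA
  h := 1
  hinv := 1
  h_symm := transpose_one
  h_mul := one_mul 1
  h_const a α β := by simp

/-- The geometry of the spatial metric along the adapted derivatives `δ/δx^i`. -/
def spaceFrame : EinsteinFrame G.Fn (Fin n) Unit (Fin n × Fin p) where
  D a := G.dδ a.1
  V := G.dV
  g := G.gA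
  Γ a := christoffel G.dδ G.gA G.gA⁻¹ a.1
  Θ e := christoffel (fun k => G.dV (k, e.2)) G.gA G.gA⁻¹ e.1
  T a b e := G.dδ b.1 (G.NA e a.1) - G.dδ a.1 (G.NA e b.1)
  K c e e' := G.dV e (G.NA e' c.1)
  compatD a := christoffel_compat _ G.gA_symm (nonsing_inv_mul _ G.isUnit_det_gA) a.1
  compatV e := christoffel_compat (fun k => G.dV (k, e.2)) G.gA_symm
    (nonsing_inv_mul _ G.isUnit_det_gA) e.1
  commDD a b f := adapted_comm G.NA G.dX_comm G.dX_dV G.dV_comm a.1 b.1 f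
  commDV c e f := adapted_comm_vert G.NA G.dX_dV G.dV_comm c.1 e f
  jacobi a b c e := adapted_jacobi G.NA G.dX_comm G.dX_dV G.dV_comm rfl a.1 b.1 c.1 e
  ginv := G.gA⁻¹
  g_symm := G.gA_symm
  ginv_mul := nonsing_inv_mul _ G.isUnit_det_gA
  h := 1
  hinv := 1
  h_symm := transpose_one
  h_mul := one_mul 1
  h_const a α β := by simp

/-- `F` does not depend on the jet coordinates `x^i_α`. -/
def VInv (F : JetPt p n → ℝ) : Prop := ∀ z w, F (z + (0, 0, w)) = F z

theorem VInv.pdV_eq_zero {F : JetPt p n → ℝ} (h : VInv F) (i : Fin n) (α : Fin p)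
    (z : JetPt p n) : pdV i α F z = 0 := by
  by_cases hF : DifferentiableAt ℝ F z
  · rw [pdV, ← hF.lineDeriv_eq_fderiv, lineDeriv]
    have : (fun t : ℝ => F (z + t • ((0, 0, Pi.single i (Pi.single α 1)) : JetPt p n))) =
        fun _ => F z := by
      funext t
      rw [Prod.smul_mk, Prod.smul_mk, smul_zero, smul_zero, h]
    rw [this, deriv_const]
  -- Where `F` is not differentiable, `fderiv` takes its default value 0.
  · rw [pdV, fderiv_zero_of_not_differentiableAt hF]
    rfl

/-- `fderiv` commutes with translations, so invariance passes to derivatives without any smoothness,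
even outside the domain. -/
theorem VInv.pdT {F : JetPt p n → ℝ} (h : VInv F) (α : Fin p) : VInv (pdT α F) := fun z w => by
  have h1 : (fun y => F (y + (0, 0, w))) = F := funext fun y => h y w
  have h2 := fderiv_comp_add_right (𝕜 := ℝ) (f := F) (x := z) (0, 0, w)
  rw [h1] at h2
  rw [_root_.pdT, ← h2]
  rfl

theorem VInv.hLow (α β : Fin p) : VInv (G.hLow α β) := fun z w => by
  simp [GMLSpace.hLow]

theorem VInv.hUp (α β : Fin p) : VInv (G.hUp α β) := fun z w => by
  simp [GMLSpace.hUp]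

theorem dV_hA (e : Fin n × Fin p) (α β : Fin p) : G.dV e (G.hA α β) = 0 := by
  refine ext_ev fun z => ?_
  rw [(G.rep_hLow α β).pdV e.1 e.2 z, map_zero]
  exact (VInv.hLow G α β).pdV_eq_zero _ _ _

/-- The geometry of the vertical metric along the derivatives `∂/∂x^i_α`. -/
def vertFrame : EinsteinFrame G.Fn (Fin n) (Fin p) Empty where
  D := G.dV
  V := nofun
  g := G.gA
  Γ a := christoffel (fun k => G.dV (k, a.2)) G.gA G.gA⁻¹ a.1
  Θ := nofun
  T := fun _ _ => nofun
  K := fun _ => nofun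
  compatD a := christoffel_compat (fun k => G.dV (k, a.2)) G.gA_symm
    (nonsing_inv_mul _ G.isUnit_det_gA) a.1
  compatV := nofun
  commDD a b f := by
    rw [G.dV_comm, sub_self, Fintype.sum_empty]
  commDV := fun _ => nofun
  jacobi := fun _ _ _ => nofun
  ginv := G.gA⁻¹
  g_symm := G.gA_symm
  ginv_mul := nonsing_inv_mul _ G.isUnit_det_gA
  h := G.hA
  hinv := G.hA⁻¹
  h_symm := G.hA_symm
  h_mul := mul_nonsing_inv _ G.isUnit_det_hA
  h_const := G.dV_hA

end GMLSpace

end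

noncomputable section

/-! ### Reordering of finite sums -/

section Sums

variable {M a b c d : Type*} [AddCommMonoid M] [Fintype a] [Fintype b] [Fintype c] [Fintype d]

theorem sum_rotate₃ (f : a → b → c → M) :
    ∑ i, ∑ j, ∑ k, f i j k = ∑ j, ∑ k, ∑ i, f i j k := by
  rw [Finset.sum_comm]
  exact Finset.sum_congr rfl fun _ _ => Finset.sum_comm

theorem sum_rotate₄ (f : a → b → c → d → M) :
    ∑ i, ∑ j, ∑ k, ∑ l, f i j k l = ∑ j, ∑ k, ∑ l, ∑ i, f i j k l := by
  rw [Finset.sum_comm]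
  exact Finset.sum_congr rfl fun _ _ => sum_rotate₃ _

end Sums

namespace MetricFrame

variable {A ι κ E : Type*} [CommRing A] [Algebra ℝ A] [Fintype ι] [Fintype E]
  (F : MetricFrame A ι κ E)

theorem Ω_apply (a b : ι × κ) (l i : ι) : F.Ω a b l i =
    F.D b (F.Γ a l i) - F.D a (F.Γ b l i)
      + ∑ m, (F.Γ a m i * F.Γ b l m - F.Γ b m i * F.Γ a l m) + ∑ e, F.Θ e l i * F.T a b e := by
  simp only [Ω, Matrix.add_apply, Matrix.sub_apply, Matrix.map_apply, Matrix.mul_apply,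
    Matrix.sum_apply, Matrix.smul_apply, smul_eq_mul, Finset.sum_sub_distrib, mul_comm]
  ring

theorem P_apply (c : ι × κ) (e : E) (l i : ι) : F.P c e l i =
    F.V e (F.Γ c l i) - F.D c (F.Θ e l i)
      + ∑ m, (F.Γ c m i * F.Θ e l m - F.Θ e m i * F.Γ c l m) + ∑ f, F.Θ f l i * F.K c e f := by
  simp only [P, Matrix.add_apply, Matrix.sub_apply, Matrix.map_apply, Matrix.mul_apply,
    Matrix.sum_apply, Matrix.smul_apply, smul_eq_mul, Finset.sum_sub_distrib, mul_comm]
  ring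

end MetricFrame

/-! ### Matching the frames with the coordinate formulas -/

namespace GMLSpace

open smoothFn Matrix

variable {p n : ℕ} (G : GMLSpace p n)

theorem gUp_comm {z : JetPt p n} (hz : z ∈ G.dom) (i j : Fin n) : G.gUp i j z = G.gUp j i z := by
  have h := G.spaceFrame.ginv_comm i j
  have := congrArg (ev (⟨z, hz⟩ : G.U)) h
  exact ((G.rep_gUp i j ⟨z, hz⟩).symm.trans this).trans (G.rep_gUp j i ⟨z, hz⟩)

theorem hLow_comm {z : JetPt p n} (hz : z ∈ G.dom) (α β : Fin p) :
    G.hLow α β z = G.hLow β α z :=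
  congrFun₂ (G.h_symm _ (G.fst_mem z hz)) β α

/-! ### The spatial identity -/

theorem rep_cartanL (i j k : Fin n) (u : Unit) :
    Rep (G.spaceFrame.Γ (k, u) i j) (G.cartanL i j k) := fun z => by
  change ev z ((1 / 2 : ℝ) • ∑ m, G.gA⁻¹ i m *
    (G.dδ k (G.gA m j) + G.dδ j (G.gA m k) - G.dδ m (G.gA j k))) = _
  simp only [map_smul, map_sum, map_mul, map_add, map_sub, G.rep_gUp _ _ z,
    (G.rep_gLow _ _).deltaX _ z]
  rfl

theorem rep_cartanC_space (i j k : Fin n) (γ : Fin p) :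
    Rep (G.spaceFrame.Θ (k, γ) i j) (G.cartanC i j k γ) := fun z => by
  change ev z ((1 / 2 : ℝ) • ∑ m, G.gA⁻¹ i m *
    (G.dV (k, γ) (G.gA m j) + G.dV (j, γ) (G.gA m k) - G.dV (m, γ) (G.gA j k))) = _
  simp only [map_smul, map_sum, map_mul, map_add, map_sub, G.rep_gUp _ _ z,
    (G.rep_gLow _ _).pdV _ _ z]
  rfl

theorem rep_torR (m : Fin n) (μ : Fin p) (i j : Fin n) (u v : Unit) :
    Rep (G.spaceFrame.T (i, u) (j, v) (m, μ)) (G.torR m μ i j) := fun z => by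
  change ev z (G.dδ j (G.NA (m, μ) i) - G.dδ i (G.NA (m, μ) j)) = _
  rw [map_sub, (G.rep_N _ _ _).deltaX _ z, (G.rep_N _ _ _).deltaX _ z]
  rfl

theorem rep_curvR (l i j k : Fin n) (u v : Unit) :
    Rep (G.spaceFrame.Ω (j, u) (k, v) l i) (G.curvR l i j k) := fun z => by
  rw [MetricFrame.Ω_apply]
  change ev z (G.dδ k _ - G.dδ j _ + _ + _) = _
  simp only [map_sum, map_mul, map_add, map_sub, Fintype.sum_prod_type, G.rep_cartanL _ _ _ _ z,
    G.rep_cartanC_space _ _ _ _ z, G.rep_torR _ _ _ _ _ _ z, (G.rep_cartanL _ _ _ _).deltaX _ z]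
  rfl

/-- The L term of the torsion `torP` cancels the term of `covXC` in which the connection acts on the
vertical index, leaving the bracket coefficient ∂N/∂x^k_γ, which is `K`. -/
theorem rep_curvP (l i j k : Fin n) (γ : Fin p) (u : Unit) :
    Rep (G.spaceFrame.P (j, u) (k, γ) l i) (G.curvP l i j k γ) := fun z => by
  rw [MetricFrame.P_apply]
  change ev z (G.dV (k, γ) _ - G.dδ j _ + _ + ∑ f, _ * G.dV (k, γ) (G.NA f j)) = _
  simp only [map_sum, map_mul, map_add, map_sub, Fintype.sum_prod_type, G.rep_cartanL _ _ _ _ z,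
    G.rep_cartanC_space _ _ _ _ z, (G.rep_N _ _ _).pdV _ _ z, (G.rep_cartanL _ _ _ _).pdV _ _ z,
    (G.rep_cartanC_space _ _ _ _).deltaX _ z]
  have h1 : ∑ m, ∑ μ, G.cartanC l i m μ z * G.torP m μ j k γ z =
      ∑ m, ∑ μ, G.cartanC l i m μ z * pdV k γ (G.N m μ j) z
      - ∑ m, G.cartanC l i m γ z * G.cartanL m k j z := by
    simp only [torP, kron, mul_sub, Finset.sum_sub_distrib, ite_mul, one_mul, zero_mul, mul_ite,
      mul_zero, Finset.sum_ite_eq, Finset.mem_univ, if_true]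
  rw [curvP, covXC, h1, Finset.sum_sub_distrib]
  have h2 : ∑ m, G.cartanL m i j z * G.cartanC l m k γ z =
      ∑ m, G.cartanC l m k γ z * G.cartanL m i j z :=
    Finset.sum_congr rfl fun _ _ => mul_comm _ _
  rw [h2]
  ring

theorem rep_ricR (i j : Fin n) (u v : Unit) :
    Rep (G.spaceFrame.ric i u j v) (G.ricR i j) := fun z => by
  simp only [EinsteinFrame.ric, map_sum, G.rep_curvR _ _ _ _ _ _ z]
  rfl

theorem rep_scalR : Rep G.spaceFrame.scal G.scalR := fun z => by
  have h1 : ∀ i j, ev z (G.spaceFrame.ginv i j) = G.gUp i j z := fun i j => G.rep_gUp i j z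
  have h2 : ∀ u v, G.spaceFrame.h u v = 1 := fun _ _ => rfl
  simp only [EinsteinFrame.scal, map_sum, map_mul, h1, h2, G.rep_ricR _ _ _ _ z, one_mul,
    Finset.univ_unique, Finset.sum_singleton]
  rfl

theorem rep_einX (i j : Fin n) (u v : Unit) :
    Rep (G.spaceFrame.ein i u j v) (G.einX i j) := fun z => by
  have h1 : ∀ i j, ev z (G.spaceFrame.g i j) = G.gLow i j z := fun i j => rfl
  have h2 : ∀ u v, G.spaceFrame.hinv u v = 1 := fun _ _ => rfl
  simp only [EinsteinFrame.ein, map_sub, map_mul, map_smul, h1, h2, G.rep_ricR _ _ _ _ z, mul_one, G.rep_scalR z, einX, smul_eq_mul]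
  ring

theorem rep_einXmix (i j : Fin n) (u v : Unit) :
    Rep (G.spaceFrame.einMix i u j v) (G.einXmix i j) := fun z => by
  have h1 : ∀ i j, ev z (G.spaceFrame.ginv i j) = G.gUp i j z := fun i j => G.rep_gUp i j z
  have h2 : ∀ u v, G.spaceFrame.h u v = 1 := fun _ _ => rfl
  simp only [EinsteinFrame.einMix, map_sum, map_mul, h1, h2, G.rep_einX _ _ _ _ z, mul_one, Finset.univ_unique, Finset.sum_singleton]
  rfl

theorem rep_covX (m i k : Fin n) (u v w : Unit) :
    Rep (G.spaceFrame.covMix (k, w) (fun a b => G.spaceFrame.einMix a u b v) m i)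
      (G.covX G.einXmix m i k) := fun z => by
  change ev z (G.dδ k _ + _ - _) = _
  simp only [map_sum, map_mul, map_add, map_sub, (G.rep_einXmix _ _ _ _).deltaX _ z,
    G.rep_einXmix _ _ _ _ z, G.rep_cartanL _ _ _ _ z]
  rfl

/-- L is symmetric in its lower indices, so only the bracket part of `U` survives. -/
theorem U_space (a b c : Fin n × Unit) (l i : Fin n) : G.spaceFrame.U a b c l i =
    ∑ m, ∑ μ, G.spaceFrame.T a b (m, μ) * G.spaceFrame.P c (m, μ) l i := by
  have h : ∀ s, G.spaceFrame.tor a b s = 0 := fun s => by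
    have : G.spaceFrame.Γ b s.1 a.1 = G.spaceFrame.Γ a s.1 b.1 :=
      christoffel_symm G.dδ _ G.gA_symm s.1 a.1 b.1
    rw [EinsteinFrame.tor, this]
    exact sub_self _
  simp only [EinsteinFrame.U, h, zero_smul, Finset.sum_const_zero, add_zero, Matrix.sum_apply,
    Matrix.smul_apply, smul_eq_mul, Fintype.sum_prod_type]

theorem div_einXmix {z : JetPt p n} (hz : z ∈ G.dom) (i : Fin n) :
    ∑ m, G.covX G.einXmix m i m z =
      -((∑ m, ∑ μ, ∑ l, G.torR m μ i l z * G.curvPmix l m μ z)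
        - 1 / 2 * ∑ k, ∑ s, ∑ m, ∑ μ, ∑ l,
            G.gUp k s z * G.torR m μ k l z * G.curvP l s i m μ z) := by
  have key := congrArg (ev (⟨z, hz⟩ : G.U)) (G.spaceFrame.div_einMix
    (fun a b e => (neg_sub _ _).symm) (i, ()))
  have h1 : ∀ i j, ev (⟨z, hz⟩ : G.U) (G.spaceFrame.ginv i j) = G.gUp i j z :=
    fun i j => G.rep_gUp i j ⟨z, hz⟩
  have h2 : ∀ u v, G.spaceFrame.h u v = 1 := fun _ _ => rfl
  simp only [map_sum, map_neg, map_sub, map_smul, map_mul, Finset.univ_unique,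
    Finset.sum_singleton, EinsteinFrame.contract, h1, h2, one_mul, U_space,
    G.rep_covX _ _ _ _ _ _ ⟨z, hz⟩, G.rep_torR _ _ _ _ _ _ ⟨z, hz⟩,
    G.rep_curvP _ _ _ _ _ _ ⟨z, hz⟩, smul_eq_mul] at key
  rw [key]
  congr 2
  -- The inverse metric of the contraction is absorbed into the trace `curvPmix`; the rest is
  -- renaming and reordering.
  · simp only [curvPmix, Finset.mul_sum]
    have h3 : ∀ j s : Fin n, ∑ l, ∑ m, ∑ μ, G.gUp j s z * (G.torR m μ i l z * G.curvP l s j m μ z) =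
        ∑ m, ∑ μ, ∑ l, G.torR m μ i l z * (G.gUp s j z * G.curvP l s j m μ z) := by
      intro j s
      rw [sum_rotate₃, G.gUp_comm hz]
      simp only [mul_left_comm]
    simp only [h3]
    rw [Finset.sum_comm]
    rw [Finset.sum_congr rfl fun s _ => sum_rotate₄ _, sum_rotate₄]
  · congr 1
    refine Finset.sum_congr rfl fun k _ => Finset.sum_congr rfl fun s _ => ?_
    simp only [Finset.mul_sum, mul_assoc]
    rw [Finset.sum_comm]
    exact Finset.sum_congr rfl fun m _ => Finset.sum_comm


/-! ### The vertical identity -/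

theorem rep_cartanC (i j k : Fin n) (γ : Fin p) :
    Rep (G.vertFrame.Γ (k, γ) i j) (G.cartanC i j k γ) := G.rep_cartanC_space i j k γ

theorem rep_torS (m : Fin n) (μ : Fin p) (i : Fin n) (α : Fin p) (j : Fin n) (β : Fin p) :
    Rep (G.vertFrame.tor (i, α) (j, β) (m, μ)) (G.torS m μ i α j β) := fun z => by
  have h : ∀ P : Prop, ∀ _ : Decidable P, ev z (if P then (1 : G.Fn) else 0) = if P then 1 else 0 :=
    fun P _ => by split_ifs <;> simp
  simp only [EinsteinFrame.tor, map_sub, map_mul, h, G.rep_cartanC _ _ _ _ z]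
  rfl

theorem rep_curvS (l i j : Fin n) (β : Fin p) (k : Fin n) (γ : Fin p) :
    Rep (G.vertFrame.Ω (j, β) (k, γ) l i) (G.curvS l i j β k γ) := fun z => by
  rw [MetricFrame.Ω_apply]
  change ev z (G.dV (k, γ) _ - G.dV (j, β) _ + _ + _) = _
  simp only [map_sum, map_mul, map_add, map_sub, G.rep_cartanC _ _ _ _ z,
    (G.rep_cartanC _ _ _ _).pdV _ _ z, Finset.univ_eq_empty, Finset.sum_empty, add_zero]
  rfl

theorem rep_ricS (i : Fin n) (α : Fin p) (j : Fin n) (β : Fin p) :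
    Rep (G.vertFrame.ric i α j β) (G.ricS i α j β) := fun z => by
  simp only [EinsteinFrame.ric, map_sum, G.rep_curvS _ _ _ _ _ _ z]
  rfl

theorem rep_scalS : Rep G.vertFrame.scal G.scalS := fun z => by
  have h1 : ∀ i j, ev z (G.vertFrame.ginv i j) = G.gUp i j z := fun i j => G.rep_gUp i j z
  have h2 : ∀ α β, ev z (G.vertFrame.h α β) = G.hLow α β z := fun _ _ => rfl
  simp only [EinsteinFrame.scal, map_sum, map_mul, h1, h2, G.rep_ricS _ _ _ _ z]
  rfl

theorem rep_einV (i : Fin n) (α : Fin p) (j : Fin n) (β : Fin p) :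
    Rep (G.vertFrame.ein i α j β) (G.einV i α j β) := fun z => by
  have h1 : ∀ i j, ev z (G.vertFrame.g i j) = G.gLow i j z := fun i j => rfl
  have h2 : ∀ α β, ev z (G.vertFrame.hinv α β) = G.hUp α β z := fun α β => G.rep_hUp α β z
  simp only [EinsteinFrame.ein, map_sub, map_mul, map_smul, h1, h2, G.rep_ricS _ _ _ _ z,
    G.rep_scalS z, einV, smul_eq_mul]
  ring

theorem rep_einVmix (i : Fin n) (α : Fin p) (j : Fin n) (β : Fin p) :
    Rep (G.vertFrame.einMix i α j β) (G.einVmix i α j β) := fun z => by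
  have h1 : ∀ i j, ev z (G.vertFrame.ginv i j) = G.gUp i j z := fun i j => G.rep_gUp i j z
  have h2 : ∀ α β, ev z (G.vertFrame.h α β) = G.hLow α β z := fun _ _ => rfl
  simp only [EinsteinFrame.einMix, map_sum, map_mul, h1, h2, G.rep_einV _ _ _ _ z]
  rfl

theorem rep_covV (m : Fin n) (μ : Fin p) (i : Fin n) (α : Fin p) (k : Fin n) (γ : Fin p) :
    Rep (G.vertFrame.covMix (k, γ) (fun a b => G.vertFrame.einMix a μ b α) m i)
      (G.covV G.einVmix m μ i α k γ) := fun z => by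
  change ev z (G.dV (k, γ) _ + _ - _) = _
  simp only [map_sum, map_mul, map_add, map_sub, (G.rep_einVmix _ _ _ _).pdV _ _ z,
    G.rep_einVmix _ _ _ _ z, G.rep_cartanC _ _ _ _ z]
  rfl

/-- The derivatives ∂/∂x^i_α commute, so here only the torsion part of `U` survives. -/
theorem U_vert (a b c : Fin n × Fin p) (l i : Fin n) : G.vertFrame.U a b c l i =
    ∑ m, ∑ μ, G.vertFrame.tor a b (m, μ) * G.vertFrame.Ω c (m, μ) l i := by
  simp only [EinsteinFrame.U, Finset.univ_eq_empty, Finset.sum_empty, zero_add, Matrix.sum_apply,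
    Matrix.smul_apply, smul_eq_mul, Fintype.sum_prod_type]

theorem div_einVmix {z : JetPt p n} (hz : z ∈ G.dom) (i : Fin n) (α : Fin p) :
    ∑ m, ∑ μ, G.covV G.einVmix m μ i α m μ z =
      -((∑ m, ∑ μ, ∑ l, ∑ δ, G.torS m μ i α l δ z * G.curvSmix l δ m μ z)
        - 1 / 2 * ∑ k, ∑ s, ∑ δ, ∑ γ, ∑ m, ∑ μ, ∑ l,
            G.gUp k s z * G.hLow δ γ z * G.torS m μ k γ l δ z
              * G.curvS l s i α m μ z) := by
  have key := congrArg (ev (⟨z, hz⟩ : G.U)) (G.vertFrame.div_einMix (fun a b => nofun) (i, α))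
  have h1 : ∀ i j, ev (⟨z, hz⟩ : G.U) (G.vertFrame.ginv i j) = G.gUp i j z :=
    fun i j => G.rep_gUp i j ⟨z, hz⟩
  have h2 : ∀ α β, ev (⟨z, hz⟩ : G.U) (G.vertFrame.h α β) = G.hLow α β z := fun _ _ => rfl
  simp only [map_sum, map_neg, map_sub, map_smul, map_mul, EinsteinFrame.contract, h1, h2, U_vert,
    G.rep_covV _ _ _ _ _ _ ⟨z, hz⟩, G.rep_torS _ _ _ _ _ _ ⟨z, hz⟩,
    G.rep_curvS _ _ _ _ _ _ ⟨z, hz⟩, smul_eq_mul] at key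
  rw [key]
  congr 2
  · simp only [curvSmix, Finset.mul_sum]
    have h3 : ∀ (β γ : Fin p) (j s : Fin n), ∑ l, ∑ m, ∑ μ, G.hLow β γ z *
          (G.gUp j s z * (G.torS m μ i α l γ z * G.curvS l s j β m μ z)) =
        ∑ m, ∑ μ, ∑ l, G.torS m μ i α l γ z *
          (G.gUp s j z * G.hLow γ β z * G.curvS l s j β m μ z) := by
      intro β γ j s
      rw [sum_rotate₃, G.gUp_comm hz, G.hLow_comm hz]
      refine Finset.sum_congr rfl fun m _ => Finset.sum_congr rfl fun μ _ =>
        Finset.sum_congr rfl fun l _ => ?_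
      ring
    simp only [h3]
    calc
      _ = ∑ γ, ∑ s, ∑ j, ∑ β, ∑ m, ∑ μ, ∑ l, G.torS m μ i α l γ z *
          (G.gUp s j z * G.hLow γ β z * G.curvS l s j β m μ z) := by
        rw [Finset.sum_comm]
        refine Finset.sum_congr rfl fun γ _ => ?_
        rw [sum_rotate₃, Finset.sum_comm]
      _ = ∑ γ, ∑ m, ∑ μ, ∑ l, ∑ s, ∑ j, ∑ β, G.torS m μ i α l γ z *
          (G.gUp s j z * G.hLow γ β z * G.curvS l s j β m μ z) := by
        refine Finset.sum_congr rfl fun γ _ => ?_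
        refine (Finset.sum_congr rfl fun s _ => ?_).trans (sum_rotate₄ _)
        rw [Finset.sum_congr rfl fun j _ => sum_rotate₄ _, sum_rotate₄]
      _ = _ := sum_rotate₄ _
  · congr 1
    calc
      _ = ∑ γ, ∑ β, ∑ j, ∑ s, ∑ m, ∑ μ, ∑ l, G.gUp j s z * G.hLow γ β z * G.torS m μ j β l γ z
              * G.curvS l s i α m μ z := by
        rw [Finset.sum_comm]
        refine Finset.sum_congr rfl fun γ _ => Finset.sum_congr rfl fun β _ => ?_
        simp only [Finset.mul_sum]
        refine Finset.sum_congr rfl fun j _ => Finset.sum_congr rfl fun s _ => ?_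
        rw [sum_rotate₃, G.hLow_comm hz]
        refine Finset.sum_congr rfl fun m _ => Finset.sum_congr rfl fun μ _ =>
          Finset.sum_congr rfl fun l _ => ?_
        ring
      _ = _ := by
        rw [Finset.sum_congr rfl fun γ _ => sum_rotate₃ _, sum_rotate₃]

/-! ### The temporal identity -/

theorem rep_chrisH (γ α β : Fin p) (u : Unit) :
    Rep (G.timeFrame.Γ (β, u) γ α) (G.chrisH γ α β) := fun z => by
  change ev z ((1 / 2 : ℝ) • ∑ m, G.hA⁻¹ γ m *
    (G.dT β (G.hA m α) + G.dT α (G.hA m β) - G.dT m (G.hA α β))) = _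
  simp only [map_smul, map_sum, map_mul, map_add, map_sub, G.rep_hUp _ _ z,
    (G.rep_hLow _ _).pdT _ z]
  rfl

theorem rep_curvH (α η β γ : Fin p) (u v : Unit) :
    Rep (G.timeFrame.Ω (β, u) (γ, v) α η) (G.curvH α η β γ) := fun z => by
  rw [MetricFrame.Ω_apply]
  change ev z (G.dT γ _ - G.dT β _ + _ + _) = _
  simp only [map_sum, map_mul, map_add, map_sub, G.rep_chrisH _ _ _ _ z,
    (G.rep_chrisH _ _ _ _).pdT _ z, Finset.univ_eq_empty, Finset.sum_empty, add_zero]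
  rfl

theorem rep_ricH (α β : Fin p) (u v : Unit) :
    Rep (G.timeFrame.ric α u β v) (G.ricH α β) := fun z => by
  simp only [EinsteinFrame.ric, map_sum, G.rep_curvH _ _ _ _ _ _ z]
  rfl

theorem rep_scalH : Rep G.timeFrame.scal G.scalH := fun z => by
  have h1 : ∀ α β, ev z (G.timeFrame.ginv α β) = G.hUp α β z := fun α β => G.rep_hUp α β z
  have h2 : ∀ u v, G.timeFrame.h u v = 1 := fun _ _ => rfl
  simp only [EinsteinFrame.scal, map_sum, map_mul, h1, h2, G.rep_ricH _ _ _ _ z, one_mul,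
    Finset.univ_unique, Finset.sum_singleton]
  rfl

theorem rep_einT (α β : Fin p) (u v : Unit) :
    Rep (G.timeFrame.ein α u β v) (G.einT α β) := fun z => by
  have h1 : ∀ α β, ev z (G.timeFrame.g α β) = G.hLow α β z := fun _ _ => rfl
  have h2 : ∀ u v, G.timeFrame.hinv u v = 1 := fun _ _ => rfl
  simp only [EinsteinFrame.ein, map_sub, map_mul, map_smul, h1, h2, G.rep_ricH _ _ _ _ z,
    mul_one, G.rep_scalH z, einT, smul_eq_mul]
  ring

theorem rep_einTmix (α β : Fin p) (u v : Unit) :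
    Rep (G.timeFrame.einMix α u β v) (G.einTmix α β) := fun z => by
  have h1 : ∀ α β, ev z (G.timeFrame.ginv α β) = G.hUp α β z := fun α β => G.rep_hUp α β z
  have h2 : ∀ u v, G.timeFrame.h u v = 1 := fun _ _ => rfl
  simp only [EinsteinFrame.einMix, map_sum, map_mul, h1, h2, G.rep_einT _ _ _ _ z,
    mul_one, Finset.univ_unique, Finset.sum_singleton]
  rfl

theorem VInv.chrisH (γ α β : Fin p) : VInv (G.chrisH γ α β) := fun z w => by
  simp only [GMLSpace.chrisH, VInv.hUp G _ _ z w, (VInv.hLow G _ _).pdT _ z w]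

theorem VInv.curvH (α η β γ : Fin p) : VInv (G.curvH α η β γ) := fun z w => by
  simp only [GMLSpace.curvH, VInv.chrisH G _ _ _ z w, (VInv.chrisH G _ _ _).pdT _ z w]

theorem VInv.ricH (α β : Fin p) : VInv (G.ricH α β) := fun z w => by
  simp only [GMLSpace.ricH, VInv.curvH G _ _ _ _ z w]

theorem VInv.einTmix (α β : Fin p) : VInv (G.einTmix α β) := fun z w => by
  simp only [GMLSpace.einTmix, einT, scalH, VInv.hUp G _ _ z w, VInv.hLow G _ _ z w,
    VInv.ricH G _ _ z w]

/-- The Einstein tensor of `h` does not depend on the jet coordinates, so the correction of δ/δt by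
the nonlinear connection `M` vanishes on it. -/
theorem rep_covT (α β γ : Fin p) (u v w : Unit) :
    Rep (G.timeFrame.covMix (γ, w) (fun a b => G.timeFrame.einMix a u b v) α β)
      (G.covT G.einTmix α β γ) := fun z => by
  change ev z (G.dT γ _ + _ - _) = _
  simp only [map_sum, map_mul, map_add, map_sub, (G.rep_einTmix _ _ _ _).pdT _ z,
    G.rep_einTmix _ _ _ _ z, G.rep_chrisH _ _ _ _ z, covT, deltaT,
    (VInv.einTmix G α β).pdV_eq_zero, mul_zero, Finset.sum_const_zero, sub_zero]

theorem U_time (a b c : Fin p × Unit) : G.timeFrame.U a b c = 0 := by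
  have h : ∀ s, G.timeFrame.tor a b s = 0 := fun s => by
    have : G.timeFrame.Γ b s.1 a.1 = G.timeFrame.Γ a s.1 b.1 :=
      christoffel_symm G.dT _ G.hA_symm s.1 a.1 b.1
    rw [EinsteinFrame.tor, this]
    exact sub_self _
  simp only [EinsteinFrame.U, h, zero_smul, Finset.sum_const_zero, add_zero,
    Finset.univ_eq_empty, Finset.sum_empty]

theorem div_einTmix {z : JetPt p n} (hz : z ∈ G.dom) (β : Fin p) :
    ∑ μ, G.covT G.einTmix μ β μ z = 0 := by
  have key := congrArg (ev (⟨z, hz⟩ : G.U)) (G.timeFrame.div_einMix (fun a b => nofun) (β, ()))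
  simpa only [map_sum, U_time, EinsteinFrame.contract_zero, smul_zero, sub_zero, neg_zero,
    map_zero, Finset.univ_unique, Finset.sum_singleton, G.rep_covT _ _ _ _ _ _ ⟨z, hz⟩] using key

end GMLSpace
end

theorem mainTheorem6 (p n : ℕ) (G : GMLSpace p n) (z : JetPt p n) (hz : z ∈ G.dom) :
    (∀ β : Fin p, ∑ μ, G.covT G.einTmix μ β μ z = 0) ∧
    (∀ i : Fin n, ∑ m, G.covX G.einXmix m i m z =
      -((∑ m, ∑ μ, ∑ l, G.torR m μ i l z * G.curvPmix l m μ z)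
        - 1 / 2 * ∑ k, ∑ s, ∑ m, ∑ μ, ∑ l,
            G.gUp k s z * G.torR m μ k l z * G.curvP l s i m μ z)) ∧
    (∀ (i : Fin n) (α : Fin p), ∑ m, ∑ μ, G.covV G.einVmix m μ i α m μ z =
      -((∑ m, ∑ μ, ∑ l, ∑ δ, G.torS m μ i α l δ z * G.curvSmix l δ m μ z)
        - 1 / 2 * ∑ k, ∑ s, ∑ δ, ∑ γ, ∑ m, ∑ μ, ∑ l,
            G.gUp k s z * G.hLow δ γ z * G.torS m μ k γ l δ z
              * G.curvS l s i α m μ z)) :=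
  ⟨G.div_einTmix hz, G.div_einXmix hz, G.div_einVmix hz⟩
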